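/- \textbf{Setting.} Let $\mathbb K$ be a field. An \emph{ice quiver} $(Q,F)$ is a finite quiver $Q$ without loops together with a (not necessarily full) subquiver $F$. Vertices and arrows in $F$ are called frozen, the others mutable (or unfrozen); write $Q_0^{\mathrm m}=Q_0\setminus F_0$ and $Q_1^{\mathrm m}=Q_1\setminus F_1$. For an arrow $\alpha$, $t\alpha$ and $h\alpha$ denote its tail and head, and paths are composed from right to left. A \emph{potential} $W$ is a (finite) $\mathbb K$-linear combination of cycles (of positive length) of $Q$, and $\partial_\alpha$ is the linear map given on cycles by $$\partial_\alpha(\alpha_n\cdots\alpha_1)=\sum_{\alpha_i=\alpha}\alpha_{i-1}\cdots\alpha_1\alpha_n\cdots\alpha_{i+1}.$$ Let $\widehat{\mathbb KQ}$ be the completion of the path algebra with respect to the arrow ideal. The \emph{frozen Jacobian algebra} is $$A=J(Q,F,W)=\widehat{\mathbb KQ}\big/\,\overline{\langle \partial_\alpha W:\alpha\in Q_1^{\mathrm m}\rangle},$$ the quotient by the closure, in the topology defined by the powers of the arrow ideal, of the two-sided ideal generated by the $\partial_\alpha W$ with $\alpha$ unfrozen. Its \emph{frozen idempotent} is $e=\sum_{v\in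 F_0}e_v$. \textbf{The complex.} Let $S=\prod_{v\in Q_0}\mathbb K e_v\subseteq A$ be the semisimple algebra spanned by the vertex idempotents (for $A\ne 0$, the quotient of $A$ by its arrow ideal). Consider the $S$-bimodules $\mathbb KQ_0$ with basis $e_v$ $(v\in Q_0)$, $\mathbb KQ_1$ with basis the arrows $\alpha=e_{h\alpha}\alpha e_{t\alpha}$ $(\alpha\in Q_1)$, $\mathbb KQ_2^{\mathrm m}$ with basis symbols $\rho_\alpha=e_{t\alpha}\rho_\alpha e_{h\alpha}$ $(\alpha\in Q_1^{\mathrm m})$, and $\mathbb KQ_3^{\mathrm m}$ with basis symbols $\omega_v=e_v\omega_ve_v$ $(v\in Q_0^{\mathrm m})$. Let $\mathrm{Res}(A)$ be the complex of $A$-bimodules, with terms in homological degrees $3,2,1,0$, $$A\otimes_S\mathbb KQ_3^{\mathrm m}\otimes_SA\xrightarrow{\mu_3}A\otimes_S\mathbb KQ_2^{\mathrm m}\otimes_SA\xrightarrow{\mu_2}A\otimes_S\mathbb KQ_1\otimes_SA\xrightarrow{\mu_1}A\otimes_S\mathbb KQ_0\otimes_SA$$ with $$\mu_1(x\otimes\alpha\otimes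 y)=x\otimes e_{h\alpha}\otimes\alpha y-x\alpha\otimes e_{t\alpha}\otimes y,\qquad \mu_2(x\otimes\rho_\alpha\otimes y)=\sum_{\beta\in Q_1}x\,\Delta_\beta(\partial_\alpha W)\,y,$$ $$\mu_3(x\otimes\omega_v\otimes y)=\sum_{t\alpha=v}x\otimes\rho_\alpha\otimes\alpha y-\sum_{h\beta=v}x\beta\otimes\rho_\beta\otimes y,$$ where $\Delta_\beta$ is linear with $\Delta_\beta(\alpha_m\cdots\alpha_1)=\sum_{\alpha_i=\beta}\alpha_m\cdots\alpha_{i+1}\otimes\alpha_i\otimes\alpha_{i-1}\cdots\alpha_1$. The multiplication map $\mu_0\colon A\otimes_S\mathbb KQ_0\otimes_SA\cong A\otimes_SA\to A$ defines a morphism of complexes $\mu_0\colon\mathrm{Res}(A)\to A$. \textbf{Definition.} Let $A$ be a $\mathbb K$-algebra, $e\in A$ an idempotent, $d\ge0$ an integer, and let $A^{\mathrm e}=A\otimes_{\mathbb K}A^{\mathrm{op}}$, so that $A$-bimodules are $A^{\mathrm e}$-modules. Put $\Omega_A=\mathrm{RHom}_{A^{\mathrm e}}(A,A^{\mathrm e})$,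 a complex of bimodules via the inner action: if $f(m)=u\otimes v$ then $(xfy)(m)=uy\otimes xv$. The algebra $A$ is \emph{bimodule internally $d$-Calabi--Yau} with respect to $e$ if (i) the projective dimension of $A$ over $A^{\mathrm e}$ is at most $d$; (ii) $A$ is perfect over $A^{\mathrm e}$, that is, quasi-isomorphic to a bounded complex of finitely generated projective $A^{\mathrm e}$-modules; (iii) there is a triangle $A\to\Omega_A[d]\to C\to A[1]$ in the derived category $\mathcal D(A^{\mathrm e})$ such that $\mathrm{RHom}_A(C,M)=0$ for every $M\in\mathcal D(A)$ and $\mathrm{RHom}_{A^{\mathrm{op}}}(C,N)=0$ for every $N\in\mathcal D(A^{\mathrm{op}})$ whose total cohomology is finite dimensional over $\mathbb K$ and annihilated by the ideal $AeA$. \textbf{Theorem.} Let $A=J(Q,F,W)$ be a frozen Jacobian algebra with frozen idempotent $e$. If $\mu_0\colon\mathrm{Res}(A)\to A$ is a quasi-isomorphism, then $A$ is bimodule internally $3$-Calabi--Yau with respect to $e$. -/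

import Mathlib

open CategoryTheory TensorProduct MulOpposite
universe u v

set_option linter.unusedSectionVars false

/-- Formal power series in noncommuting variables indexed by `E`: arbitrary families of
coefficients indexed by the words in `E`. -/
def NCSeries (K : Type*) (E : Type*) := List E → K

namespace NCSeries

@[ext] theorem ext {K E : Type*} {f g : NCSeries K E} (h : ∀ l, f l = g l) : f = g := funext h

variable {K : Type*} {E : Type*} [Field K]

instance : AddCommGroup (NCSeries K E) := inferInstanceAs (AddCommGroup (List E → K))
instance : Module K (NCSeries K E) := inferInstanceAs (Module K (List E → K))

open Classical in
/-- The word `p`, with coefficient one. -/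
noncomputable def single (p : List E) : NCSeries K E := fun l => if l = p then 1 else 0

/-- The concatenation (Cauchy) product. -/
def mul (f g : NCSeries K E) : NCSeries K E :=
  fun l => ∑ i ∈ Finset.range (l.length + 1), f (l.take i) * g (l.drop i)

noncomputable instance : One (NCSeries K E) := ⟨single []⟩
instance : Mul (NCSeries K E) := ⟨mul⟩

theorem add_apply (f g : NCSeries K E) (l : List E) : (f + g) l = f l + g l := rfl
theorem zero_apply (l : List E) : (0 : NCSeries K E) l = 0 := rfl
theorem smul_apply (c : K) (f : NCSeries K E) (l : List E) : (c • f) l = c * f l := rfl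
theorem mul_apply (f g : NCSeries K E) (l : List E) :
    (f * g) l = ∑ i ∈ Finset.range (l.length + 1), f (l.take i) * g (l.drop i) := rfl

/-- Auxiliary: the series of coefficients of words that start with `a`. -/
def shift (a : E) (f : NCSeries K E) : NCSeries K E := fun l => f (a :: l)

theorem mul_nil (f g : NCSeries K E) : (f * g) [] = f [] * g [] := by simp [mul_apply]
theorem mul_cons (f g : NCSeries K E) (a : E) (l : List E) :
    (f * g) (a :: l) = f [] * g (a :: l) + (shift a f * g) l := by
  rw [mul_apply, mul_apply, List.length_cons, Finset.sum_range_succ', add_comm]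
  simp [shift]

protected theorem one_apply (l : List E) : (1 : NCSeries K E) l = if l = [] then 1 else 0 := by
  change (if l = [] then (1 : K) else 0) = _
  congr

theorem shift_one (a : E) : shift a (1 : NCSeries K E) = 0 := by
  ext l; simp [shift, NCSeries.one_apply, zero_apply]

theorem shift_mul (a : E) (f g : NCSeries K E) :
    shift a (f * g) = f [] • shift a g + shift a f * g := by
  ext l; simp only [shift, mul_cons, add_apply, smul_apply]

theorem add_mul' (f g h : NCSeries K E) : (f + g) * h = f * h + g * h := by
  ext l; simp only [mul_apply, add_apply, add_mul, Finset.sum_add_distrib]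
theorem mul_add' (f g h : NCSeries K E) : f * (g + h) = f * g + f * h := by
  ext l; simp only [mul_apply, add_apply, mul_add, Finset.sum_add_distrib]
theorem zero_mul' (f : NCSeries K E) : 0 * f = 0 := by
  ext l; simp only [mul_apply, zero_apply, zero_mul, Finset.sum_const_zero]
theorem mul_zero' (f : NCSeries K E) : f * 0 = 0 := by
  ext l; simp only [mul_apply, zero_apply, mul_zero, Finset.sum_const_zero]
theorem smul_mul' (c : K) (f g : NCSeries K E) : (c • f) * g = c • (f * g) := by
  ext l; simp only [mul_apply, smul_apply, mul_assoc, Finset.mul_sum]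
theorem mul_smul' (c : K) (f g : NCSeries K E) : f * (c • g) = c • (f * g) := by
  ext l; simp only [mul_apply, smul_apply, Finset.mul_sum, mul_left_comm]

theorem one_mul' (f : NCSeries K E) : 1 * f = f := by
  ext l
  cases l with
  | nil => simp [mul_nil, NCSeries.one_apply]
  | cons a l => simp [mul_cons, NCSeries.one_apply, shift_one, zero_mul', zero_apply]

theorem mul_one' (f : NCSeries K E) : f * 1 = f := by
  ext l
  induction l generalizing f with
  | nil => simp [mul_nil, NCSeries.one_apply]
  | cons a l ih => rw [mul_cons, ih]; simp [NCSeries.one_apply, shift]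

theorem mul_assoc' (f g h : NCSeries K E) : f * g * h = f * (g * h) := by
  ext l
  induction l generalizing f g h with
  | nil => simp [mul_nil, mul_assoc]
  | cons a l ih =>
    rw [mul_cons, mul_cons f, shift_mul, mul_nil, add_mul', smul_mul', add_apply, smul_apply,
      ih, mul_cons g, mul_add, mul_assoc, add_assoc]

noncomputable instance : Ring (NCSeries K E) :=
  { (inferInstance : AddCommGroup (NCSeries K E)) with
    mul := (· * ·)
    one := 1
    left_distrib := mul_add'
    right_distrib := add_mul'
    zero_mul := zero_mul'
    mul_zero := mul_zero'
    mul_assoc := mul_assoc'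
    one_mul := one_mul'
    mul_one := mul_one' }

noncomputable instance : Algebra K (NCSeries K E) :=
  Algebra.ofModule smul_mul' mul_smul'

end NCSeries

/-- An ice quiver `(Q, F)`: a quiver `Q` with vertices `V` and arrows `E` (both are finite wherever
it is used) without loops, together with a subquiver `F`, not necessarily full, given by the sets
`frozenV` of its vertices and `frozenE` of its arrows. -/
structure IceQuiver (V : Type*) (E : Type*) where
  /-- the tail of an arrow -/
  src : E → V
  /-- the head of an arrow -/
  tgt : E → V
  no_loops : ∀ α, src α ≠ tgt α
  frozenV : Finset V
  frozenE : Finset E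
  src_mem : ∀ α ∈ frozenE, src α ∈ frozenV
  tgt_mem : ∀ α ∈ frozenE, tgt α ∈ frozenV

namespace IceQuiver
variable {V : Type*} {E : Type*} (Q : IceQuiver V E)

/-- `Q.IsPath w l v` says that the list `l` is a path from `v` to `w`. A path `αₙ ⋯ α₁` is written
as the list `[αₙ, …, α₁]`, so the first entry of the list is the last arrow that is traversed;
the empty list is the trivial path at `v = w`. -/
def IsPath (w : V) : List E → V → Prop
  | [], v => w = v
  | α :: l, v => Q.tgt α = w ∧ IsPath (Q.src α) l v

theorem IsPath.append {w u v : V} {p q : List E} (hp : Q.IsPath w p u) (hq : Q.IsPath u q v) :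
    Q.IsPath w (p ++ q) v := by
  induction p generalizing w with
  | nil => cases hp; exact hq
  | cons α p ih => exact ⟨hp.1, ih hp.2⟩

section alg
variable (K : Type*) [Field K] [Fintype V] [DecidableEq V]

/-- The completion of the path algebra `KQ` at the arrow ideal. Its elements are arbitrary (possibly
infinite) `K`-linear combinations of the paths of `Q`, multiplied by concatenation of paths. A
combination is recorded as the `V × V` matrix whose entry at `(w, v)` is the part carried by the
paths from `v` to `w`; the product of matrices is then the product of such combinations. -/
noncomputable def completedPathAlgebra : Subalgebra K (Matrix V V (NCSeries K E)) where
  carrier := {M | ∀ w v l, M w v l ≠ 0 → Q.IsPath w l v}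
  mul_mem' := by
    intro M N hM hN w v l h
    rw [Matrix.mul_apply] at h
    have key : (∑ u, M w u * N u v : NCSeries K E) l = ∑ u, (M w u * N u v) l :=
      Finset.sum_apply l _ _
    rw [key] at h
    obtain ⟨u, -, hu⟩ := Finset.exists_ne_zero_of_sum_ne_zero h
    rw [NCSeries.mul_apply] at hu
    obtain ⟨i, -, hi⟩ := Finset.exists_ne_zero_of_sum_ne_zero hu
    have := IsPath.append Q (hM _ _ _ (left_ne_zero_of_mul hi)) (hN _ _ _ (right_ne_zero_of_mul hi))
    rwa [List.take_append_drop] at this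
  add_mem' := by
    intro M N hM hN w v l h
    by_cases h1 : M w v l = 0
    · refine hN w v l fun h2 => h ?_
      rw [Matrix.add_apply, NCSeries.add_apply, h1, h2, add_zero]
    · exact hM w v l h1
  algebraMap_mem' := by
    intro c w v l h
    rw [Matrix.algebraMap_matrix_apply] at h
    split_ifs at h with hwv
    · rw [Algebra.algebraMap_eq_smul_one, NCSeries.smul_apply, NCSeries.one_apply] at h
      split_ifs at h with hl
      · subst hl; exact hwv
      · simp at h
    · exact absurd (NCSeries.zero_apply l) h

theorem vertex_mem (v : V) :
    (Matrix.single v v 1 : Matrix V V (NCSeries K E)) ∈ Q.completedPathAlgebra K := by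
  intro w u l h
  rw [Matrix.single_apply] at h
  split_ifs at h with hv
  · rw [NCSeries.one_apply] at h
    split_ifs at h with hl
    · subst hl; exact hv.1.symm.trans hv.2
    · simp at h
  · exact absurd (NCSeries.zero_apply l) h

theorem arrow_mem (α : E) :
    (Matrix.single (Q.tgt α) (Q.src α) (NCSeries.single [α]) : Matrix V V (NCSeries K E)) ∈
      Q.completedPathAlgebra K := by
  intro w u l h
  rw [Matrix.single_apply] at h
  split_ifs at h with hv
  · unfold NCSeries.single at h
    split_ifs at h with hl
    · subst hl; exact hv
    · simp at h
  · exact absurd (NCSeries.zero_apply l) h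

/-- The idempotent (trivial path) at the vertex `v`. -/
noncomputable def vertex (v : V) : Q.completedPathAlgebra K := ⟨_, Q.vertex_mem K v⟩

/-- The arrow `α` as an element of the completed path algebra. -/
noncomputable def arrow (α : E) : Q.completedPathAlgebra K := ⟨_, Q.arrow_mem K α⟩

variable {K}

/-- Two elements agree on all paths of length less than `n`, that is, they are congruent modulo
the `n`-th power of the (closed) arrow ideal. -/
def AgreeBelow (n : ℕ) (x y : Q.completedPathAlgebra K) : Prop :=
  ∀ w v l, l.length < n → x.1 w v l = y.1 w v l

theorem AgreeBelow.mul {n : ℕ} {x x' y y' : Q.completedPathAlgebra K}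
    (hx : Q.AgreeBelow n x x') (hy : Q.AgreeBelow n y y') :
    Q.AgreeBelow n (x * y) (x' * y') := by
  intro w v l hl
  have key : ∀ M N : Matrix V V (NCSeries K E),
      (M * N) w v l = ∑ u, (M w u * N u v) l := fun M N => by
    rw [Matrix.mul_apply]; exact Finset.sum_apply l _ _
  change (x.1 * y.1) w v l = (x'.1 * y'.1) w v l
  rw [key, key]
  refine Finset.sum_congr rfl fun u _ => ?_
  rw [NCSeries.mul_apply, NCSeries.mul_apply]
  refine Finset.sum_congr rfl fun i _ => ?_
  rw [hx _ _ _ (lt_of_le_of_lt (by simp) hl), hy _ _ _ (lt_of_le_of_lt (by simp) hl)]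

/-- The closure of a two-sided ideal in the arrow-ideal-adic topology: the elements which can be
approximated by elements of `I` up to paths of any given length. -/
noncomputable def closure (I : TwoSidedIdeal (Q.completedPathAlgebra K)) :
    Ideal (Q.completedPathAlgebra K) where
  carrier := {x | ∀ n, ∃ y ∈ I, Q.AgreeBelow n x y}
  add_mem' := by
    intro a b ha hb n
    obtain ⟨y, hy, h⟩ := ha n
    obtain ⟨z, hz, h'⟩ := hb n
    refine ⟨y + z, I.add_mem hy hz, fun w v l hl => ?_⟩
    change a.1 w v l + b.1 w v l = y.1 w v l + z.1 w v l
    rw [h w v l hl, h' w v l hl]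
  zero_mem' := fun n => ⟨0, I.zero_mem, fun _ _ _ _ => rfl⟩
  smul_mem' := by
    intro c x hx n
    obtain ⟨y, hy, h⟩ := hx n
    exact ⟨c * y, I.mul_mem_left _ _ hy, AgreeBelow.mul Q (fun _ _ _ _ => rfl) h⟩

instance (I : TwoSidedIdeal (Q.completedPathAlgebra K)) : (Q.closure I).IsTwoSided where
  mul_mem_of_left := by
    intro x c hx n
    obtain ⟨y, hy, h⟩ := hx n
    exact ⟨y * c, I.mul_mem_right _ _ hy, AgreeBelow.mul Q h (fun _ _ _ _ => rfl)⟩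

/-- Cycles: paths of positive length whose head and tail agree. -/
def IsCycle (l : List E) : Prop := l ≠ [] ∧ ∃ v, Q.IsPath v l v

variable (K) in
/-- A potential: a linear combination of cycles. -/
abbrev Potential := {l : List E // Q.IsCycle l} →₀ K

/-- The cyclic derivative `∂_α W`, a linear combination of paths: linear in `W`, with
`∂_α (αₙ ⋯ α₁) = ∑_{αᵢ = α} αᵢ₋₁ ⋯ α₁ αₙ ⋯ αᵢ₊₁`. As `Q` has no loops, a cycle has at least two
arrows and no trivial path occurs here. -/
noncomputable def cyclicDerivative [DecidableEq E] (W : Q.Potential K) (α : E) : List E →₀ K :=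
  W.sum fun l c => ∑ i : Fin l.1.length,
    if l.1[i] = α then Finsupp.single (l.1.drop (i + 1) ++ l.1.take i) c else 0

/-- The element of the completed path algebra given by a linear combination of paths of positive
length. -/
noncomputable def toCompleted (x : List E →₀ K) : Q.completedPathAlgebra K :=
  Finsupp.linearCombination K (fun p => (p.map (Q.arrow K)).prod) x

variable [DecidableEq E] (W : Q.Potential K)

/-- The two-sided ideal generated by the `∂_α W` with `α` unfrozen. -/
noncomputable def jacobianIdeal : TwoSidedIdeal (Q.completedPathAlgebra K) :=
  TwoSidedIdeal.span {x | ∃ α, α ∉ Q.frozenE ∧ x = Q.toCompleted (Q.cyclicDerivative W α)}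

/-- The frozen Jacobian algebra `J(Q, F, W)`. -/
abbrev FrozenJacobian := Q.completedPathAlgebra K ⧸ Q.closure (Q.jacobianIdeal W)

end alg
end IceQuiver

/- Derived categories are the localizations constructed in Mathlib. -/
attribute [local instance] HasDerivedCategory.standard

noncomputable section

section Exact
variable {R : Type*} {R' : Type*} [Ring R] [Ring R'] (f : R →+* R')

theorem restrictScalars_map_exact (S : ShortComplex (ModuleCat.{v} R')) (h : S.Exact) :
    (S.map (ModuleCat.restrictScalars.{v} f)).Exact := by
  rw [ShortComplex.ShortExact.moduleCat_exact_iff_function_exact] at h ⊢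
  exact h

instance restrictScalars_preservesFiniteLimits :
    Limits.PreservesFiniteLimits (ModuleCat.restrictScalars.{v} f) := by
  have := ((Functor.exact_tfae (ModuleCat.restrictScalars.{v} f)).out 1 3).mp
    (restrictScalars_map_exact f)
  exact this.1

instance restrictScalars_preservesFiniteColimits :
    Limits.PreservesFiniteColimits (ModuleCat.restrictScalars.{v} f) := by
  have := ((Functor.exact_tfae (ModuleCat.restrictScalars.{v} f)).out 1 3).mp
    (restrictScalars_map_exact f)
  exact this.2
end Exact

/-- The enveloping algebra `A ⊗[K] Aᵐᵒᵖ`; `A`-bimodules are left modules over it. -/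
def Env (K : Type*) (A : Type*) [Field K] [Ring A] [Algebra K A] := A ⊗[K] Aᵐᵒᵖ

namespace Env
section
variable (K : Type u) (A : Type v) [Field K] [Ring A] [Algebra K A]

instance : Ring (Env K A) := inferInstanceAs (Ring (A ⊗[K] Aᵐᵒᵖ))
instance : Algebra K (Env K A) := inferInstanceAs (Algebra K (A ⊗[K] Aᵐᵒᵖ))

variable {A} in
/-- The element `x ⊗ y` of the enveloping algebra; it acts on bimodules by `m ↦ x m y`. -/
def tmul (x y : A) : Env K A := x ⊗ₜ[K] op y

theorem tmul_mul_tmul (x y x' y' : A) :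
    tmul K x y * tmul K x' y' = tmul K (x * x') (y' * y) :=
  Algebra.TensorProduct.tmul_mul_tmul x x' (op y) (op y')

theorem add_tmul (x x' y : A) : tmul K (x + x') y = tmul K x y + tmul K x' y :=
  TensorProduct.add_tmul x x' (op y)

theorem tmul_add (x y y' : A) : tmul K x (y + y') = tmul K x y + tmul K x y' :=
  TensorProduct.tmul_add x (op y) (op y')

theorem smul_tmul (c : K) (x y : A) : tmul K (c • x) y = c • tmul K x y :=
  TensorProduct.smul_tmul' c x (op y)

theorem tmul_smul (c : K) (x y : A) : tmul K x (c • y) = c • tmul K x y :=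
  TensorProduct.tmul_smul c x (op y)

/-- `A` as a bimodule over itself. -/
instance instModule : Module (Env K A) A :=
  Module.compHom A (AlgHom.mulLeftRight K A : A ⊗[K] Aᵐᵒᵖ →ₐ[K] Module.End K A).toRingHom

variable {A} in
theorem tmul_smul_self (x y a : A) : tmul K x y • a = x * a * y :=
  AlgHom.mulLeftRight_apply K A x (op y) a

/-- The homomorphism `x ↦ x ⊗ 1`; restriction along it forgets the right action. -/
def leftHom : A →ₐ[K] Env K A :=
  (Algebra.TensorProduct.includeLeft : A →ₐ[K] A ⊗[K] Aᵐᵒᵖ)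
/-- The homomorphism `y ↦ 1 ⊗ y`; restriction along it forgets the left action. -/
def rightHom : Aᵐᵒᵖ →ₐ[K] Env K A :=
  (Algebra.TensorProduct.includeRight : Aᵐᵒᵖ →ₐ[K] A ⊗[K] Aᵐᵒᵖ)

theorem leftHom_apply (x : A) : leftHom K A x = tmul K x 1 := rfl
theorem rightHom_apply (y : A) : rightHom K A (op y) = tmul K 1 y := rfl

/-- The anti-automorphism `x ⊗ y ↦ y ⊗ x` of the enveloping algebra. -/
def flip : Env K A →ₐ[K] (Env K A)ᵐᵒᵖ :=
  (Algebra.TensorProduct.lift (AlgHom.opComm.symm (rightHom K A)) (AlgHom.op (leftHom K A))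
    (fun x y => unop_injective (by
      change leftHom K A (unop y) * rightHom K A (op x) = rightHom K A (op x) * leftHom K A (unop y)
      simp [leftHom_apply, rightHom_apply, tmul_mul_tmul])) :
    A ⊗[K] Aᵐᵒᵖ →ₐ[K] (Env K A)ᵐᵒᵖ)

theorem flip_tmul (x y : A) : flip K A (tmul K x y) = op (tmul K y x) := by
  refine (Algebra.TensorProduct.lift_tmul _ _ _ _ _).trans (unop_injective ?_)
  change leftHom K A y * rightHom K A (op x) = tmul K y x
  simp [leftHom_apply, rightHom_apply, tmul_mul_tmul]

/-- The bimodule dual `Hom_{Aᵉ}(M, Aᵉ)`, where the homomorphisms are formed with the outer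
bimodule structure on `Aᵉ` and the inner one is retained: if `f m = u ⊗ v`, then
`(x f y) m = u y ⊗ x v` (see `Dual.smul_apply`). -/
def Dual (M : Type*) [AddCommGroup M] [Module (Env K A) M] := M →ₗ[Env K A] Env K A

section
variable (M : Type*) [AddCommGroup M] [Module (Env K A) M]
instance : AddCommGroup (Dual K A M) := inferInstanceAs (AddCommGroup (M →ₗ[Env K A] Env K A))
instance : Module (Env K A) (Dual K A M) :=
  letI : Module (Env K A)ᵐᵒᵖ (Dual K A M) :=
    inferInstanceAs (Module (Env K A)ᵐᵒᵖ (M →ₗ[Env K A] Env K A))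
  Module.compHom _ (flip K A).toRingHom

theorem Dual.smul_apply (x y : A) (f : Dual K A M) (m : M) :
    DFunLike.coe (F := M →ₗ[Env K A] Env K A) (tmul K x y • f) m =
      DFunLike.coe (F := M →ₗ[Env K A] Env K A) f m * tmul K y x := by
  change (flip K A (tmul K x y)) • (DFunLike.coe (F := M →ₗ[Env K A] Env K A) f m) = _
  rw [flip_tmul]; rfl

end

/-- The functor `Hom_{Aᵉ}(-, Aᵉ)` from bimodules to bimodules. -/
def dualFunctor : (ModuleCat.{v} (Env K A))ᵒᵖ ⥤ ModuleCat.{v} (Env K A) where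
  obj M := ModuleCat.of (Env K A) (Dual K A M.unop)
  map {M N} φ := ModuleCat.ofHom
    { toFun := fun f => LinearMap.comp (M₂ := M.unop) f φ.unop.hom
      map_add' := fun _ _ => rfl
      map_smul' := fun _ _ => rfl }

instance : (dualFunctor K A).Additive where
  map_add := by
    intro M N φ ψ
    ext f
    exact LinearMap.comp_add (M₂ := M.unop) _ _ f

/-- The bimodule `A`. -/
abbrev diagonal : ModuleCat.{v} (Env K A) := ModuleCat.of (Env K A) A

/-- The bimodule `A` as a stalk complex in degree zero of the derived category of bimodules. -/
def diagonalObj : DerivedCategory (ModuleCat.{v} (Env K A)) :=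
  (DerivedCategory.singleFunctor _ 0).obj (diagonal K A)

/-- The cochain complex `Hom_{Aᵉ}(P, Aᵉ)`, with `Hom_{Aᵉ}(Pₙ, Aᵉ)` in degree `n ≥ 0`. -/
def dualComplex {M : ModuleCat.{v} (Env K A)} (P : ProjectiveResolution M) :
    CochainComplex (ModuleCat.{v} (Env K A)) ℤ :=
  HomologicalComplex.extend
    (((dualFunctor K A).mapHomologicalComplex (ComplexShape.up ℕ)).obj P.complex.op)
    ComplexShape.embeddingUpNat

/-- The object `RHom_{Aᵉ}(A, Aᵉ)` of the derived category of bimodules, computed by a projective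
resolution of the bimodule `A`. -/
def omega : DerivedCategory (ModuleCat.{v} (Env K A)) :=
  DerivedCategory.Q.obj (dualComplex K A (projectiveResolution (diagonal K A)))

/-- The restriction of complexes of bimodules to complexes of left `A`-modules. -/
def toLeft : DerivedCategory (ModuleCat.{v} (Env K A)) ⥤ DerivedCategory (ModuleCat.{v} A) :=
  (ModuleCat.restrictScalars.{v} (leftHom K A).toRingHom).mapDerivedCategory

/-- The restriction of complexes of bimodules to complexes of right `A`-modules, that is, of left
`Aᵐᵒᵖ`-modules. -/
def toRight : DerivedCategory (ModuleCat.{v} (Env K A)) ⥤ DerivedCategory (ModuleCat.{v} Aᵐᵒᵖ) :=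
  (ModuleCat.restrictScalars.{v} (rightHom K A).toRingHom).mapDerivedCategory
end
end Env

/-- Perfect objects: isomorphic in the derived category to a bounded complex of finitely generated
projective modules. -/
def IsPerfectObj {R : Type v} [Ring R] (X : DerivedCategory (ModuleCat.{v} R)) : Prop :=
  ∃ P : CochainComplex (ModuleCat.{v} R) ℤ,
    (∃ a b : ℤ, ∀ i, i < a ∨ b < i → Limits.IsZero (P.X i)) ∧
    (∀ i, Module.Projective R (P.X i) ∧ Module.Finite R (P.X i)) ∧
    Nonempty (DerivedCategory.Q.obj P ≅ X)

/-- `RHom(C, M) = 0`: as the `i`-th cohomology of `RHom(C, M)` is `Hom(C, M[i])`, all these vanish. -/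
def RHomVanishes {R : Type v} [Ring R] (C M : DerivedCategory (ModuleCat.{v} R)) : Prop :=
  ∀ (i : ℤ) (f : C ⟶ M⟦i⟧), f = 0

/-- For `B` the quotient of `R` by the two-sided ideal generated by `e`, the objects of the derived
category of `R` whose cohomology modules are `B`-modules and whose total cohomology is finite
dimensional over `K`. -/
def IsFiniteDimSupported (K : Type u) {R : Type v} [Field K] [Ring R] [Algebra K R] (e : R) (M : DerivedCategory (ModuleCat.{v} R)) : Prop :=
  (∀ (i : ℤ), ∀ a ∈ TwoSidedIdeal.span {e},
    ∀ x : (DerivedCategory.homologyFunctor (ModuleCat.{v} R) i).obj M, a • x = 0) ∧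
  (∀ i : ℤ, Module.Finite K ((ModuleCat.restrictScalars (algebraMap K R)).obj
      ((DerivedCategory.homologyFunctor (ModuleCat.{v} R) i).obj M))) ∧
  {i : ℤ | ¬ Limits.IsZero ((DerivedCategory.homologyFunctor (ModuleCat.{v} R) i).obj M)}.Finite

/-- The `K`-algebra `A` is bimodule internally `d`-Calabi–Yau with respect to the idempotent `e`. -/
structure IsBimoduleInternallyCY (K : Type u) {A : Type v} [Field K] [Ring A] [Algebra K A]
    (e : A) (d : ℕ) : Prop where
  /-- `e` is an idempotent. -/
  idem : IsIdempotentElem e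
  /-- The projective dimension of the bimodule `A` is at most `d`. -/
  projDim : HasProjectiveDimensionLE (Env.diagonal K A) d
  /-- The bimodule `A` is a perfect complex of bimodules. -/
  perfect : IsPerfectObj (Env.diagonalObj K A)
  /-- There is a triangle `A ⟶ RHom_{Aᵉ}(A, Aᵉ)[d] ⟶ C ⟶ A[1]` for which `RHom_A(C, M)` and
  `RHom_{Aᵒᵖ}(C, N)` vanish for all complexes `M` of left and `N` of right modules whose cohomology
  is of finite total dimension and annihilated by `AeA`. -/
  triangle : ∃ (C : DerivedCategory (ModuleCat.{v} (Env K A)))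
    (ψ : Env.diagonalObj K A ⟶ (Env.omega K A)⟦(d : ℤ)⟧)
    (g : (Env.omega K A)⟦(d : ℤ)⟧ ⟶ C) (h : C ⟶ (Env.diagonalObj K A)⟦(1 : ℤ)⟧),
    Pretriangulated.Triangle.mk ψ g h ∈ Pretriangulated.distinguishedTriangles ∧
    (∀ M, IsFiniteDimSupported K e M → RHomVanishes ((Env.toLeft K A).obj C) M) ∧
    (∀ N, IsFiniteDimSupported K (op e) N → RHomVanishes ((Env.toRight K A).obj C) N)

section Bimod
variable (K : Type*) {A V ι : Type*} [Field K] [Ring A] [Algebra K A]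

/-- The bimodule `A ⊗_S X ⊗_S A`, where `S` is the product of copies of `K` indexed by `V`, acting on
`A` through the orthogonal idempotents `e v`, and `X` is the `S`-bimodule with a `K`-basis indexed by
the finite set `ι` whose `i`-th element `b` satisfies `e (l i) · b · e (r i) = b`. It is given as the
direct sum over `i` of the bimodules `A e (l i) ⊗_K e (r i) A`, realized as the left ideals of the
enveloping algebra generated by the elements `e (l i) ⊗ e (r i)`. -/
abbrev TensorBimod (e : V → A) (l r : ι → V) : Type _ :=
  (i : ι) → ↥(Submodule.span (Env K A) {Env.tmul K (e (l i)) (e (r i))})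

namespace TensorBimod
variable [DecidableEq ι] (e : V → A) (l r : ι → V)

/-- The element `1 ⊗ i ⊗ 1`, that is, `e (l i) ⊗ e (r i)` in the `i`-th summand. -/
def gen (i : ι) : TensorBimod K e l r :=
  Pi.single i ⟨_, Submodule.mem_span_singleton_self _⟩

/-- The element `x ⊗ i ⊗ y`. -/
def tens (x : A) (i : ι) (y : A) : TensorBimod K e l r :=
  Env.tmul K x y • gen K e l r i

theorem smul_tens (a b x : A) (i : ι) (y : A) :
    Env.tmul K a b • tens K e l r x i y = tens K e l r (a * x) i (y * b) := by
  rw [tens, tens, smul_smul, Env.tmul_mul_tmul]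

theorem tens_absorb (he : ∀ v, e v * e v = e v) (x : A) (i : ι) (y : A) :
    tens K e l r (x * e (l i)) i (e (r i) * y) = tens K e l r x i y := by
  have : Env.tmul K (e (l i)) (e (r i)) • gen K e l r i = gen K e l r i := by
    rw [gen, ← Pi.single_smul]
    congr 1
    ext
    change Env.tmul K (e (l i)) (e (r i)) * (Env.tmul K (e (l i)) (e (r i))) = _
    rw [Env.tmul_mul_tmul, he, he]
  conv_rhs => rw [tens, ← this, smul_smul, Env.tmul_mul_tmul]
  rfl

theorem gen_eq_tens (i : ι) :
    gen K e l r i = tens K e l r 1 i 1 := by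
  rw [tens, show Env.tmul K (1 : A) 1 = 1 from rfl, one_smul]

theorem tens_zero_left (i : ι) (y : A) :
    tens K e l r 0 i y = 0 := by
  rw [tens, show Env.tmul K (0 : A) y = 0 from TensorProduct.zero_tmul _ _, zero_smul]

theorem tens_zero_right (i : ι) (x : A) :
    tens K e l r x i 0 = 0 := by
  rw [tens, show Env.tmul K x (0 : A) = 0 from TensorProduct.tmul_zero _ _, zero_smul]

theorem tens_eq_zero_left (he : ∀ v, e v * e v = e v)
    (x y : A) (i : ι) (h : x * e (l i) = 0) : tens K e l r x i y = 0 := by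
  rw [← tens_absorb K e l r he, h, tens, show Env.tmul K (0 : A) (e (r i) * y) = 0 from
    TensorProduct.zero_tmul _ _, zero_smul]

theorem tens_eq_zero_right (he : ∀ v, e v * e v = e v)
    (x y : A) (i : ι) (h : e (r i) * y = 0) : tens K e l r x i y = 0 := by
  rw [← tens_absorb K e l r he, h, tens, show Env.tmul K (x * e (l i)) (0 : A) = 0 from
    TensorProduct.tmul_zero _ _, zero_smul]

variable [Fintype ι] {M : Type*} [AddCommGroup M] [Module (Env K A) M]

/-- The homomorphism of bimodules with `x ⊗ i ⊗ y ↦ x e (l i) · m i · e (r i) y`. -/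
def lift (m : ι → M) : TensorBimod K e l r →ₗ[Env K A] M :=
  ∑ i, (LinearMap.toSpanSingleton (Env K A) M (m i)) ∘ₗ (Submodule.subtype _) ∘ₗ
    LinearMap.proj i

theorem lift_gen (m : ι → M) (i : ι) :
    lift K e l r m (gen K e l r i) = Env.tmul K (e (l i)) (e (r i)) • m i := by
  rw [lift, LinearMap.sum_apply, Finset.sum_eq_single i]
  · simp [gen]
  · intro j _ hj
    simp [gen, Pi.single_eq_of_ne hj]
  · simp

theorem lift_tens (m : ι → M) (x : A) (i : ι) (y : A) :
    lift K e l r m (tens K e l r x i y) =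
      Env.tmul K (x * e (l i)) (e (r i) * y) • m i := by
  rw [tens, map_smul, lift_gen, smul_smul, Env.tmul_mul_tmul]

theorem hom_ext {f g : TensorBimod K e l r →ₗ[Env K A] M}
    (h : ∀ i, f (gen K e l r i) = g (gen K e l r i)) : f = g := by
  refine LinearMap.pi_ext' fun i => LinearMap.ext fun x => ?_
  obtain ⟨x, hx⟩ := x
  obtain ⟨c, rfl⟩ := Submodule.mem_span_singleton.mp hx
  have : (LinearMap.single (Env K A) (fun i =>
      ↥(Submodule.span (Env K A) {Env.tmul K (e (l i)) (e (r i))})) i)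
        ⟨c • (Env.tmul K (e (l i)) (e (r i))), hx⟩ = c • gen K e l r i := by
    rw [gen, ← Pi.single_smul]; rfl
  rw [LinearMap.comp_apply, LinearMap.comp_apply, this, map_smul, map_smul, h]

end TensorBimod
end Bimod

namespace IceQuiver
open TensorBimod
variable {V : Type*} {E : Type*} (Q : IceQuiver V E)

/-- Mutable vertices. -/
abbrev MutableVertex := {v : V // v ∉ Q.frozenV}
/-- Unfrozen arrows. -/
abbrev MutableArrow := {α : E // α ∉ Q.frozenE}

section Maps
variable (K : Type*) {A : Type*} [Field K] [Ring A] [Algebra K A] (e : V → A) (a : E → A)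

/-- `A ⊗_S KQ₀ ⊗_S A`. -/
abbrev P₀ := TensorBimod K e (id : V → V) id
/-- `A ⊗_S KQ₁ ⊗_S A`, with a generator for each arrow, from its head to its tail. -/
abbrev P₁ := TensorBimod K e Q.tgt Q.src
/-- `A ⊗_S KQ₂ᵐ ⊗_S A`, with a generator `ρ_α` for each unfrozen arrow, from its tail to its
head. -/
abbrev P₂ := TensorBimod K e (fun α : Q.MutableArrow => Q.src α.1) (fun α => Q.tgt α.1)
/-- `A ⊗_S KQ₃ᵐ ⊗_S A`, with a generator `ω_v` for each mutable vertex. -/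
abbrev P₃ := TensorBimod K e (fun v : Q.MutableVertex => v.1) (fun v => v.1)

variable [DecidableEq V] [DecidableEq E]

/-- The element `x ⊗ v ⊗ y`. -/
abbrev t₀ (x : A) (v : V) (y : A) : P₀ K e := tens K e id id x v y
/-- The element `x ⊗ α ⊗ y`. -/
abbrev t₁ (x : A) (α : E) (y : A) : Q.P₁ K e := tens K e Q.tgt Q.src x α y
/-- The element `x ⊗ ρ_α ⊗ y`. -/
abbrev t₂ (x : A) (α : Q.MutableArrow) (y : A) : Q.P₂ K e := tens K e _ _ x α y

/-- The element of `A` given by a path. -/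
def pathProd (p : List E) : A := (p.map a).prod

/-- For a path `p = αₘ ⋯ α₁`, the sum `∑ αₘ ⋯ αᵢ₊₁ ⊗ αᵢ ⊗ αᵢ₋₁ ⋯ α₁` over all `i`; it is the sum of the
`Δ_β(p)` over all arrows `β`. -/
def Delta (p : List E) : Q.P₁ K e :=
  ∑ j : Fin p.length, Q.t₁ K e (pathProd a (p.take j)) p[j] (pathProd a (p.drop (j + 1)))

/-- The value in `A` of a linear combination of paths. -/
def evalPaths : (List E →₀ K) →ₗ[K] A := Finsupp.linearCombination K (pathProd a)

/-- The linear extension of `Delta` to linear combinations of paths. -/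
def DeltaLin : (List E →₀ K) →ₗ[K] Q.P₁ K e := Finsupp.linearCombination K (Q.Delta K e a)

variable [Fintype V] [Fintype E]

/-- The multiplication map `x ⊗ v ⊗ y ↦ x e_v y`. -/
def mu₀ : P₀ K e →ₗ[Env K A] A := lift K e _ _ e

/-- The map `x ⊗ α ⊗ y ↦ x ⊗ e_{hα} ⊗ α y - x α ⊗ e_{tα} ⊗ y`. -/
def mu₁ : Q.P₁ K e →ₗ[Env K A] P₀ K e :=
  lift K e _ _ fun α => t₀ K e 1 (Q.tgt α) (a α) - t₀ K e (a α) (Q.src α) 1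

/-- The map `x ⊗ ρ_α ⊗ y ↦ ∑_β x Δ_β(∂_α W) y`. -/
def mu₂ (W : Q.Potential K) : Q.P₂ K e →ₗ[Env K A] Q.P₁ K e :=
  lift K e _ _ fun α => Q.DeltaLin K e a (Q.cyclicDerivative W α.1)

/-- The map `x ⊗ ω_v ⊗ y ↦ ∑_{tα = v} x ⊗ ρ_α ⊗ α y - ∑_{hβ = v} x β ⊗ ρ_β ⊗ y`; all arrows at a
mutable vertex are unfrozen. -/
def mu₃ : Q.P₃ K e →ₗ[Env K A] Q.P₂ K e :=
  lift K e _ _ fun v =>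
    (∑ α : Q.MutableArrow, if Q.src α.1 = v.1 then Q.t₂ K e 1 α (a α.1) else 0) -
      ∑ β : Q.MutableArrow, if Q.tgt β.1 = v.1 then Q.t₂ K e (a β.1) β 1 else 0

/-- The relations of the path algebra: the `e v` are orthogonal with sum one (hence idempotent), and
the `a α` run from `src α` to `tgt α`. Only used to check that the complex below is a complex. -/
structure IsRep : Prop where
  sum : ∑ v, e v = 1
  mul_ne : ∀ v w, v ≠ w → e v * e w = 0
  left : ∀ α, e (Q.tgt α) * a α = a α
  right : ∀ α, a α * e (Q.src α) = a α

variable {Q K e a}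
namespace IsRep

theorem idem (h : Q.IsRep e a) (v : V) : e v * e v = e v := by
  have := congrArg (e v * ·) h.sum
  simp only [Finset.mul_sum, mul_one] at this
  rwa [Finset.sum_eq_single v (fun w _ hw => h.mul_ne v w hw.symm) (by simp)] at this

theorem zero_left (h : Q.IsRep e a) (v : V) (α : E) (hv : v ≠ Q.tgt α) : e v * a α = 0 := by
  rw [← h.left, ← mul_assoc, h.mul_ne _ _ hv, zero_mul]

theorem zero_right (h : Q.IsRep e a) (v : V) (α : E) (hv : v ≠ Q.src α) : a α * e v = 0 := by
  rw [← h.right, mul_assoc, h.mul_ne _ _ hv.symm, mul_zero]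

end IsRep

variable (K e) in
/-- The element `x ⊗ y` of `A ⊗_S A`. -/
def tensS : A →ₗ[K] A →ₗ[K] P₀ K e :=
  LinearMap.mk₂ K (fun x y => ∑ v, t₀ K e x v y)
    (fun x x' y => by simp [tens, Env.add_tmul, add_smul, Finset.sum_add_distrib])
    (fun c x y => by simp [tens, Env.smul_tmul, Finset.smul_sum])
    (fun x y y' => by simp [tens, Env.tmul_add, add_smul, Finset.sum_add_distrib])
    (fun c x y => by simp [tens, Env.tmul_smul, Finset.smul_sum])

theorem smul_tensS (x y x' y' : A) :
    Env.tmul K x y • tensS K e x' y' = tensS K e (x * x') (y' * y) := by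
  simp only [tensS, LinearMap.mk₂_apply, Finset.smul_sum, t₀, smul_tens]

theorem tensS_balanced (h : Q.IsRep e a) (x y : A) (w : V) :
    tensS K e (x * e w) y = tensS K e x (e w * y) := by
  rw [tensS, LinearMap.mk₂_apply, LinearMap.mk₂_apply, Finset.sum_eq_single w _ (by simp),
    Finset.sum_eq_single w _ (by simp)]
  · rw [t₀, t₀, ← tens_absorb K e id id h.idem, ← tens_absorb K e id id h.idem x]
    simp only [id, mul_assoc, h.idem]
    rw [← mul_assoc (e w) (e w) y, h.idem]
  · exact fun v _ hv => tens_eq_zero_right K e _ _ h.idem _ _ _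
      (by rw [← mul_assoc, id, h.mul_ne _ _ hv, zero_mul])
  · exact fun v _ hv => tens_eq_zero_left K e _ _ h.idem _ _ _
      (by rw [mul_assoc, id, h.mul_ne _ _ hv.symm, mul_zero])

theorem mu₁_tens (h : Q.IsRep e a) (x y : A) (α : E) :
    Q.mu₁ K e a (Q.t₁ K e x α y) = tensS K e x (a α * y) - tensS K e (x * a α) y := by
  have h1 : t₀ K e 1 (Q.tgt α) (a α) = tensS K e 1 (a α) := by
    rw [tensS, LinearMap.mk₂_apply, Finset.sum_eq_single (Q.tgt α) _ (by simp)]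
    exact fun v _ hv => tens_eq_zero_right K e _ _ h.idem _ _ _ (h.zero_left v α hv)
  have h2 : t₀ K e (a α) (Q.src α) 1 = tensS K e (a α) 1 := by
    rw [tensS, LinearMap.mk₂_apply, Finset.sum_eq_single (Q.src α) _ (by simp)]
    exact fun v _ hv => tens_eq_zero_left K e _ _ h.idem _ _ _ (h.zero_right v α hv)
  rw [mu₁, t₁, lift_tens, h1, h2, smul_sub, smul_tensS, smul_tensS, mul_one, one_mul,
    tensS_balanced h, ← tensS_balanced h _ y, ← mul_assoc (a α), h.right, ← mul_assoc, h.left,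
    mul_assoc x, h.left, mul_assoc x, h.right]

theorem mu₀_tensS (h : Q.IsRep e a) (x y : A) : mu₀ K e (tensS K e x y) = x * y := by
  rw [tensS, LinearMap.mk₂_apply, map_sum]
  have : ∀ v, mu₀ K e (t₀ K e x v y) = x * e v * y := fun v => by
    rw [mu₀, t₀, lift_tens, Env.tmul_smul_self, id, mul_assoc x, h.idem, mul_assoc,
      ← mul_assoc (e v) (e v), h.idem, mul_assoc]
  simp only [this]
  rw [← Finset.sum_mul, ← Finset.mul_sum, h.sum, mul_one]

theorem mu₀_comp_mu₁ (h : Q.IsRep e a) : mu₀ K e ∘ₗ Q.mu₁ K e a = 0 := by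
  refine hom_ext K e _ _ fun α => ?_
  rw [LinearMap.comp_apply, gen_eq_tens, mu₁_tens h, map_sub, mu₀_tensS h, mu₀_tensS h]
  simp

theorem Delta_cons (β : E) (p : List E) :
    Q.Delta K e a (β :: p) =
      Q.t₁ K e 1 β (pathProd a p) + Env.tmul K (a β) 1 • Q.Delta K e a p := by
  rw [Delta, Delta, Finset.smul_sum]
  refine (Fin.sum_univ_succ (n := p.length) _).trans ?_
  congr 1
  refine Finset.sum_congr rfl fun j _ => ?_
  rw [t₁, t₁, smul_tens, mul_one]
  simp [pathProd]

theorem Delta_append (p : List E) (β : E) :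
    Q.Delta K e a (p ++ [β]) =
      Env.tmul K 1 (a β) • Q.Delta K e a p + Q.t₁ K e (pathProd a p) β 1 := by
  induction p with
  | nil =>
    rw [List.nil_append, Delta_cons]
    simp [Delta, pathProd]
  | cons γ p ih =>
    rw [List.cons_append, Delta_cons, Delta_cons, ih, smul_add, smul_add, smul_smul, smul_smul,
      t₁, t₁, t₁, smul_tens, smul_tens, Env.tmul_mul_tmul, Env.tmul_mul_tmul, add_assoc]
    simp [pathProd]

theorem mu₁_Delta (h : Q.IsRep e a) (p : List E) :
    Q.mu₁ K e a (Q.Delta K e a p) =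
      tensS K e 1 (pathProd a p) - tensS K e (pathProd a p) 1 := by
  induction p with
  | nil => simp [Delta, pathProd]
  | cons β p ih =>
    rw [Delta_cons, map_add, map_smul, ih, mu₁_tens h, smul_sub, smul_tensS, smul_tensS]
    simp [pathProd]

theorem mu₁_DeltaLin (h : Q.IsRep e a) (x : List E →₀ K) :
    Q.mu₁ K e a (Q.DeltaLin K e a x) =
      tensS K e 1 (evalPaths K a x) - tensS K e (evalPaths K a x) 1 := by
  induction x using Finsupp.induction_linear with
  | zero => simp
  | add x y hx hy =>
    simp only [map_add, hx, hy, LinearMap.add_apply]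
    abel
  | single p c =>
    rw [DeltaLin, evalPaths, Finsupp.linearCombination_single, Finsupp.linearCombination_single,
      LinearMap.map_smul_of_tower, mu₁_Delta h, smul_sub]
    simp

theorem mu₁_comp_mu₂ (h : Q.IsRep e a) (W : Q.Potential K)
    (hW : ∀ α ∉ Q.frozenE, evalPaths K a (Q.cyclicDerivative W α) = 0) :
    Q.mu₁ K e a ∘ₗ Q.mu₂ K e a W = 0 := by
  refine hom_ext K e _ _ fun α => ?_
  rw [LinearMap.comp_apply, mu₂, lift_gen, map_smul, mu₁_DeltaLin h, hW _ α.2]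
  simp

theorem IsPath.src_eq {w v : V} {l : List E} (h : Q.IsPath w l v) (i : ℕ) (hi : i < l.length) :
    (∀ hi' : i + 1 < l.length, Q.src l[i] = Q.tgt l[i + 1]) ∧
      (i + 1 = l.length → Q.src l[i] = v) := by
  induction l generalizing w i with
  | nil => simp at hi
  | cons α l ih =>
    cases i with
    | zero =>
      refine ⟨fun hi' => ?_, fun hl => ?_⟩
      · cases l with
        | nil => simp at hi'
        | cons β l => exact h.2.1.symm
      · cases l with
        | nil => exact h.2
        | cons β l => simp at hl
    | succ i =>
      have := ih h.2 i (by simpa using hi)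
      refine ⟨fun hi' => by simpa using this.1 (by simpa using hi'),
        fun hl => by simpa using this.2 (by simpa using hl)⟩

theorem cycle_sum {M : Type*} [AddCommMonoid M] (F : List E → M) (l : List E)
    (hl : Q.IsCycle l) (v : V) :
    (∑ i : Fin l.length, if Q.src l[i] = v then F (l.drop (i + 1) ++ l.take i ++ [l[i]]) else 0) =
    ∑ i : Fin l.length, if Q.tgt l[i] = v then F (l[i] :: (l.drop (i + 1) ++ l.take i)) else 0 := by
  obtain ⟨hne, u, hu⟩ := hl
  have hpos : 0 < l.length := List.length_pos_iff.mpr hne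
  have : NeZero l.length := ⟨hpos.ne'⟩
  have hu0 : Q.tgt l[0] = u := by
    cases l with
    | nil => exact absurd rfl hne
    | cons α l => exact hu.1
  refine Fintype.sum_equiv (Equiv.addRight (1 : Fin l.length)) _ _ fun i => ?_
  have e1 : l.drop (i + 1) ++ l.take i ++ [l[i]] = l.drop (i + 1) ++ l.take (i + 1) := by
    rw [List.append_assoc]; simp
  have e2 : ∀ j : Fin l.length, l[j] :: (l.drop (j + 1) ++ l.take j) = l.drop j ++ l.take j := by
    intro j
    rw [← List.cons_append]; simp
  rw [e1, e2, Equiv.coe_addRight]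
  have hp := hu.src_eq i i.2
  rcases Nat.lt_or_ge (i + 1) l.length with hi | hi
  · have hv : ((i + 1 : Fin l.length) : ℕ) = i + 1 := by
      rw [Fin.val_add, Fin.val_one', Nat.add_mod_mod, Nat.mod_eq_of_lt hi]
    have := hp.1 hi
    simp only [Fin.getElem_fin, hv, this]
  · have hi' : (i : ℕ) + 1 = l.length := le_antisymm i.2 hi
    have hv : ((i + 1 : Fin l.length) : ℕ) = 0 := by
      rw [Fin.val_add, Fin.val_one', Nat.add_mod_mod, hi', Nat.mod_self]
    have := hp.2 hi'
    simp only [Fin.getElem_fin, hv, this, hu0, hi']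
    simp

theorem linearCombination_cyclicDerivative {M : Type*} [AddCommGroup M] [Module K M]
    (F : List E → M) (W : Q.Potential K) (α : E) :
    Finsupp.linearCombination K F (Q.cyclicDerivative W α) =
      W.sum fun l c => ∑ i : Fin l.1.length,
        if l.1[i] = α then c • F (l.1.drop (i + 1) ++ l.1.take i) else 0 := by
  rw [cyclicDerivative, map_finsuppSum]
  refine Finsupp.sum_congr fun l _ => ?_
  rw [map_sum]
  refine Finset.sum_congr rfl fun i _ => ?_
  split_ifs
  · rw [Finsupp.linearCombination_single]
  · rw [map_zero]

/-- Both sides sum over the cyclic rotations of `W` based at `v`. -/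
theorem sum_rotations {M : Type*} [AddCommGroup M] [Module K M] (F : List E → M)
    (W : Q.Potential K) (v : V) :
    (∑ α, if Q.src α = v then
      Finsupp.linearCombination K (fun p => F (p ++ [α])) (Q.cyclicDerivative W α) else 0) =
    ∑ β, if Q.tgt β = v then
      Finsupp.linearCombination K (fun p => F (β :: p)) (Q.cyclicDerivative W β) else 0 := by
  have key : ∀ (s : E → V) (G : E → List E → M),
      (∑ α, if s α = v then
        Finsupp.linearCombination K (G α) (Q.cyclicDerivative W α) else 0) =
      W.sum fun l c => c • ∑ i : Fin l.1.length,
        if s l.1[i] = v then G l.1[i] (l.1.drop (i + 1) ++ l.1.take i) else 0 := by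
    intro s G
    simp only [linearCombination_cyclicDerivative, Finsupp.sum]
    have : ∀ α, (if s α = v then ∑ l ∈ W.support, ∑ i : Fin l.1.length,
        (if l.1[i] = α then W l • G α (l.1.drop (i + 1) ++ l.1.take i) else 0) else 0) =
        ∑ l ∈ W.support, ∑ i : Fin l.1.length, if l.1[i] = α then
          (if s α = v then W l • G α (l.1.drop (i + 1) ++ l.1.take i) else 0) else 0 := by
      intro α
      split_ifs
      · rfl
      · simp
    simp only [this]
    rw [Finset.sum_comm]
    refine Finset.sum_congr rfl fun l _ => ?_
    rw [Finset.sum_comm, Finset.smul_sum]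
    refine Finset.sum_congr rfl fun i _ => ?_
    rw [Finset.sum_ite_eq]
    simp [smul_ite]
  rw [key Q.src (fun α p => F (p ++ [α])), key Q.tgt (fun β p => F (β :: p))]
  exact Finsupp.sum_congr fun l _ => by rw [cycle_sum F l.1 l.2 v]

theorem linearCombination_Delta_append (α : E) (x : List E →₀ K) :
    Finsupp.linearCombination K (fun p => Q.Delta K e a (p ++ [α])) x =
      Env.tmul K 1 (a α) • Q.DeltaLin K e a x + Q.t₁ K e (evalPaths K a x) α 1 := by
  induction x using Finsupp.induction_linear with
  | zero => rw [map_zero, map_zero, map_zero, smul_zero, t₁, tens_zero_left, add_zero]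
  | add x y hx hy =>
    rw [map_add, hx, hy, map_add, map_add, smul_add, t₁, t₁, t₁, tens, tens, tens,
      Env.add_tmul, add_smul]
    abel
  | single p c =>
    rw [DeltaLin, evalPaths, Finsupp.linearCombination_single, Finsupp.linearCombination_single,
      Finsupp.linearCombination_single, Delta_append, smul_add, t₁, t₁, tens, tens,
      Env.smul_tmul, smul_assoc, smul_comm c]

theorem linearCombination_Delta_cons (β : E) (x : List E →₀ K) :
    Finsupp.linearCombination K (fun p => Q.Delta K e a (β :: p)) x =
      Q.t₁ K e 1 β (evalPaths K a x) + Env.tmul K (a β) 1 • Q.DeltaLin K e a x := by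
  induction x using Finsupp.induction_linear with
  | zero => rw [map_zero, map_zero, map_zero, smul_zero, t₁, tens_zero_right, add_zero]
  | add x y hx hy =>
    rw [map_add, hx, hy, map_add, map_add, smul_add, t₁, t₁, t₁, tens, tens, tens,
      Env.tmul_add, add_smul]
    abel
  | single p c =>
    rw [DeltaLin, evalPaths, Finsupp.linearCombination_single, Finsupp.linearCombination_single,
      Finsupp.linearCombination_single, Delta_cons, smul_add, t₁, t₁, tens, tens,
      Env.tmul_smul, smul_assoc, smul_comm c (Env.tmul K (a β) 1)]

theorem mu₂_comp_mu₃ (h : Q.IsRep e a) (W : Q.Potential K)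
    (hW : ∀ α ∉ Q.frozenE, evalPaths K a (Q.cyclicDerivative W α) = 0) :
    Q.mu₂ K e a W ∘ₗ Q.mu₃ K e a = 0 := by
  refine hom_ext K e _ _ fun v => ?_
  have hsrc : ∀ α, Q.src α = v.1 → α ∉ Q.frozenE := fun α hα hF =>
    v.2 (hα ▸ Q.src_mem α hF)
  have htgt : ∀ α, Q.tgt α = v.1 → α ∉ Q.frozenE := fun α hα hF =>
    v.2 (hα ▸ Q.tgt_mem α hF)
  set D : E → Q.P₁ K e := fun α => Q.DeltaLin K e a (Q.cyclicDerivative W α) with hD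
  -- rewriting sums over mutable arrows as sums over all arrows
  have hsub : ∀ (s : E → V) (hs : ∀ α, s α = v.1 → α ∉ Q.frozenE) (g : E → Q.P₁ K e),
      (∑ α : Q.MutableArrow, if s α.1 = v.1 then g α.1 else 0) =
        ∑ α, if s α = v.1 then g α else 0 := by
    intro s hs g
    rw [← Finset.sum_subtype (Finset.univ.filter fun α => α ∉ Q.frozenE) (by simp)
      (fun α => if s α = v.1 then g α else 0), Finset.sum_filter]
    refine Finset.sum_congr rfl fun α _ => ?_
    split_ifs with h1 h2 h2
    · exact absurd h1 (hs α h2)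
    · rfl
    · rfl
    · rfl
  have hout : ∀ α : Q.MutableArrow, Q.src α.1 = v.1 →
      Q.mu₂ K e a W (Q.t₂ K e 1 α (a α.1)) =
        Env.tmul K (e v.1) (e v.1) • (Env.tmul K 1 (a α.1) • D α.1) := by
    intro α hα
    rw [mu₂, t₂, lift_tens, smul_smul, Env.tmul_mul_tmul, one_mul, mul_one, hα, h.left, ← hα,
      h.right]
  have hin : ∀ β : Q.MutableArrow, Q.tgt β.1 = v.1 →
      Q.mu₂ K e a W (Q.t₂ K e (a β.1) β 1) =
        Env.tmul K (e v.1) (e v.1) • (Env.tmul K (a β.1) 1 • D β.1) := by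
    intro β hβ
    rw [mu₂, t₂, lift_tens, smul_smul, Env.tmul_mul_tmul, one_mul, mul_one, h.right, ← hβ,
      h.left]
  have hrot := sum_rotations (Q.Delta K e a) W v.1
  have hDout : ∀ α, α ∉ Q.frozenE →
      Finsupp.linearCombination K (fun p => Q.Delta K e a (p ++ [α])) (Q.cyclicDerivative W α) =
        Env.tmul K 1 (a α) • D α := by
    intro α hα
    rw [linearCombination_Delta_append, hW α hα, t₁, tens_zero_left, add_zero]
  have hDin : ∀ β, β ∉ Q.frozenE →
      Finsupp.linearCombination K (fun p => Q.Delta K e a (β :: p)) (Q.cyclicDerivative W β) =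
        Env.tmul K (a β) 1 • D β := by
    intro β hβ
    rw [linearCombination_Delta_cons, hW β hβ, t₁, tens_zero_right, zero_add]
  rw [LinearMap.comp_apply, LinearMap.zero_apply, mu₃, lift_gen, map_smul, map_sub, map_sum,
    map_sum]
  have eout : (∑ α : Q.MutableArrow, Q.mu₂ K e a W
      (if Q.src α.1 = v.1 then Q.t₂ K e 1 α (a α.1) else 0)) =
      Env.tmul K (e v.1) (e v.1) • ∑ α, if Q.src α = v.1 then Env.tmul K 1 (a α) • D α else 0 := by
    rw [← hsub _ hsrc, Finset.smul_sum]
    refine Finset.sum_congr rfl fun α _ => ?_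
    split_ifs with hα
    · exact hout α hα
    · rw [map_zero, smul_zero]
  have ein : (∑ β : Q.MutableArrow, Q.mu₂ K e a W
      (if Q.tgt β.1 = v.1 then Q.t₂ K e (a β.1) β 1 else 0)) =
      Env.tmul K (e v.1) (e v.1) • ∑ β, if Q.tgt β = v.1 then Env.tmul K (a β) 1 • D β else 0 := by
    rw [← hsub _ htgt, Finset.smul_sum]
    refine Finset.sum_congr rfl fun β _ => ?_
    split_ifs with hβ
    · exact hin β hβ
    · rw [map_zero, smul_zero]
  have e1 : (∑ α, if Q.src α = v.1 then Env.tmul K 1 (a α) • D α else 0) =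
      ∑ β, if Q.tgt β = v.1 then Env.tmul K (a β) 1 • D β else 0 := by
    calc _ = _ := Finset.sum_congr rfl fun α _ => by
          split_ifs with hα
          · exact (hDout α (hsrc α hα)).symm
          · rfl
      _ = _ := hrot
      _ = _ := Finset.sum_congr rfl fun β _ => by
          split_ifs with hβ
          · exact hDin β (htgt β hβ)
          · rfl
  rw [eout, ein, e1, sub_self, smul_zero]

end Maps

section Jacobian
variable {K : Type*} [Field K] [Fintype V] [DecidableEq V] [Fintype E] [DecidableEq E]
variable {Q} (W : Q.Potential K)

/-- The class of the idempotent at `v` in the frozen Jacobian algebra. -/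
def vertexClass (v : V) : Q.FrozenJacobian W := Ideal.Quotient.mk _ (Q.vertex K v)

/-- The class of the arrow `α` in the frozen Jacobian algebra. -/
def arrowClass (α : E) : Q.FrozenJacobian W := Ideal.Quotient.mk _ (Q.arrow K α)

/-- The frozen idempotent: the sum of the idempotents at the frozen vertices. -/
def frozenIdempotent : Q.FrozenJacobian W := ∑ v ∈ Q.frozenV, vertexClass W v

theorem isRep : Q.IsRep (vertexClass W) (arrowClass W) where
  sum := by
    have : ∑ v, Q.vertex K v = 1 := by
      apply Subtype.ext
      rw [AddSubmonoidClass.coe_finsetSum]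
      change ∑ v, Matrix.single v v (1 : NCSeries K E) = 1
      exact Matrix.sum_single_one
    rw [← map_one (Ideal.Quotient.mk (Q.closure (Q.jacobianIdeal W))), ← this, map_sum]
    rfl
  mul_ne v w hvw := by
    have : Q.vertex K v * Q.vertex K w = 0 :=
      Subtype.ext (Matrix.single_mul_single_of_ne 1 v v w hvw 1)
    rw [vertexClass, vertexClass, ← map_mul, this, map_zero]
  left α := by
    have : Q.vertex K (Q.tgt α) * Q.arrow K α = Q.arrow K α :=
      Subtype.ext ((Matrix.single_mul_single_same _ _ _ _ _).trans (by rw [one_mul]; rfl))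
    rw [vertexClass, arrowClass, ← map_mul, this]
  right α := by
    have : Q.arrow K α * Q.vertex K (Q.src α) = Q.arrow K α :=
      Subtype.ext ((Matrix.single_mul_single_same _ _ _ _ _).trans (by rw [mul_one]; rfl))
    rw [vertexClass, arrowClass, ← map_mul, this]

theorem relations (α : E) (hα : α ∉ Q.frozenE) :
    evalPaths K (arrowClass W) (Q.cyclicDerivative W α) = 0 := by
  have h1 : ∀ x : List E →₀ K, evalPaths K (arrowClass W) x =
      Ideal.Quotient.mk (Q.closure (Q.jacobianIdeal W)) (Q.toCompleted x) := by
    intro x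
    rw [toCompleted, evalPaths, ← Ideal.Quotient.mkₐ_eq_mk K]
    refine Eq.trans ?_ (Finsupp.apply_linearCombination K
      (Ideal.Quotient.mkₐ K (Q.closure (Q.jacobianIdeal W))).toLinearMap _ x).symm
    congr 2
    funext p
    change _ = Ideal.Quotient.mk (Q.closure (Q.jacobianIdeal W)) _
    rw [map_list_prod, List.map_map]
    rfl
  rw [h1, Ideal.Quotient.eq_zero_iff_mem]
  exact fun n => ⟨_, TwoSidedIdeal.subset_span ⟨α, hα, rfl⟩, fun _ _ _ _ => rfl⟩
end Jacobian

section Complex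
universe u₁ u₂ u₃
variable {K : Type u₁} {V : Type u₂} {E : Type u₃} [Field K] [Fintype V] [DecidableEq V]
  [Fintype E] [DecidableEq E] {Q : IceQuiver V E} (W : Q.Potential K)

/-- The terms of the complex `Res(A)`. -/
def resX : ℕ → ModuleCat.{max u₁ u₂ u₃} (Env K (Q.FrozenJacobian W))
  | 0 => ModuleCat.of _ (P₀ K (vertexClass W))
  | 1 => ModuleCat.of _ (Q.P₁ K (vertexClass W))
  | 2 => ModuleCat.of _ (Q.P₂ K (vertexClass W))
  | 3 => ModuleCat.of _ (Q.P₃ K (vertexClass W))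
  | _ + 4 => ModuleCat.of _ PUnit

/-- The differentials of the complex `Res(A)`. -/
def resD : ∀ n, resX W (n + 1) ⟶ resX W n
  | 0 => ModuleCat.ofHom (Q.mu₁ K (vertexClass W) (arrowClass W))
  | 1 => ModuleCat.ofHom (Q.mu₂ K (vertexClass W) (arrowClass W) W)
  | 2 => ModuleCat.ofHom (Q.mu₃ K (vertexClass W) (arrowClass W))
  | _ + 3 => 0

theorem resD_comp : ∀ n, resD W (n + 1) ≫ resD W n = 0
  | 0 => ModuleCat.hom_ext (mu₁_comp_mu₂ (isRep W) W (relations W))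
  | 1 => ModuleCat.hom_ext (mu₂_comp_mu₃ (isRep W) W (relations W))
  | _ + 2 => Limits.zero_comp

/-- The complex `Res(A)` of bimodules, `P₃ ⟶ P₂ ⟶ P₁ ⟶ P₀` in degrees `3, 2, 1, 0`. -/
def res : ChainComplex (ModuleCat.{max u₁ u₂ u₃} (Env K (Q.FrozenJacobian W))) ℕ :=
  ChainComplex.of (resX W) (resD W) (resD_comp W)

/-- The augmentation `Res(A) ⟶ A` induced by the multiplication map `mu₀`. -/
def augmentation : res W ⟶
    (ChainComplex.single₀ (ModuleCat.{max u₁ u₂ u₃} (Env K (Q.FrozenJacobian W)))).obj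
      (Env.diagonal K (Q.FrozenJacobian W)) :=
  ((res W).toSingle₀Equiv (Env.diagonal K (Q.FrozenJacobian W))).symm
    ⟨ModuleCat.ofHom (mu₀ K (vertexClass W)), by
      have : (res W).d 1 0 = ModuleCat.ofHom (Q.mu₁ K (vertexClass W) (arrowClass W)) :=
        ChainComplex.of_d (resX W) (resD W) 0
      rw [this]
      exact ModuleCat.hom_ext (mu₀_comp_mu₁ (isRep W))⟩

end Complex
end IceQuiver

end

/-!
The complex `Res(A)`, written `P₃ ⟶ P₂ ⟶ P₁ ⟶ P₀`, is self-dual up to its frozen summands, and the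
frozen summands are invisible to modules annihilated by the frozen idempotent `e`.

*Duality.* The bimodule `A ⊗_S X ⊗_S A` is the direct sum of the projective bimodules
`A e_v ⊗ e_w A`, one for each basis element of `X` from `w` to `v`. The pairing
`⟨s, t⟩ = ∑ i, s i * swap (t i)` with values in the enveloping algebra, where
`swap (x ⊗ y) = y ⊗ x`, identifies its dual with `A ⊗_S X* ⊗_S A` (`TensorBimod.dualEquiv`). Hence
`P₂*` is the part of `P₁` that belongs to the mutable arrows, and `P₃*` the part of `P₀` that
belongs to the mutable vertices. Under the pairing the mutable parts of `mu₁` and `mu₃` are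
transposes of each other (`phi₀_comp_mu₁`, `phi₂_comp_mu₃`), and that of `mu₂` is its own transpose
(`phi₁_comp_mu₂`), because the second cyclic derivatives of a cyclic word are symmetric
(`splitSum_cyclic`). With the sign of the shift by three this gives maps of complexes
`Res(A) ⟶ (P₃ ⟶ P₂ ⟶ P₂* ⟶ P₃*) ⟶ Res(A)* [3]`. The first is a split epimorphism in each degree,
whose kernels are sums of frozen summands `A e_v ⊗ e_w A` with `v` and `w` frozen; the second is a
split monomorphism in each degree, whose cokernels are such sums.

*Orthogonality.* A frozen summand is projective, also as a left or right `A`-module, and it is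
generated under the two actions by its image under `e ⊗ e`, so it has no nonzero `A`-linear map to a
module annihilated by `e`. A map from a bounded complex of such modules to a complex whose
cohomology is annihilated by `e` is therefore null-homotopic, by descending induction on the degree
(`nonempty_homotopy_zero`, `leftOrthogonal_map_of_bounded`). So the cones of both maps above lie in
the triangulated subcategory of objects that are orthogonal to all such complexes, and hence so does
the cone of their composite (`trW_comparison`).

If `Res(A)` is quasi-isomorphic to `A`, it is a projective resolution of length three by finitely
generated bimodules, its dual computes `RHom_{Aᵉ}(A, Aᵉ)`, and the composite is the map
`A ⟶ RHom_{Aᵉ}(A, Aᵉ)[3]` of the triangle that is sought.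
-/

noncomputable section

/-! ### Bimodules given by idempotents, and their duals -/

namespace Env
variable (K : Type*) {A : Type*} [Field K] [Ring A] [Algebra K A]

/-- The anti-involution `x ⊗ y ↦ y ⊗ x` of the enveloping algebra. -/
def swap (r : Env K A) : Env K A := unop (flip K A r)

theorem swap_tmul (x y : A) : swap K (tmul K x y) = tmul K y x := by
  rw [swap, flip_tmul, unop_op]

theorem swap_add (r s : Env K A) : swap K (r + s) = swap K r + swap K s := by
  exact congrArg unop (map_add (flip K A) r s)

theorem swap_mul (r s : Env K A) : swap K (r * s) = swap K s * swap K r := by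
  exact congrArg unop (map_mul (flip K A) r s)

theorem swap_zero : swap K (0 : Env K A) = 0 := by
  rw [swap, map_zero, unop_zero]

@[elab_as_elim]
theorem induction_on {p : Env K A → Prop} (r : Env K A) (zero : p 0)
    (tmul : ∀ x y, p (tmul K x y)) (add : ∀ r s, p r → p s → p (r + s)) : p r :=
  TensorProduct.induction_on (motive := p) r zero (fun x y => tmul x (unop y)) add

theorem swap_swap (r : Env K A) : swap K (swap K r) = r := by
  induction r using induction_on with
  | zero => rw [swap_zero, swap_zero]
  | tmul x y => rw [swap_tmul, swap_tmul]
  | add r s hr hs => rw [swap_add, swap_add, hr, hs]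

end Env

namespace TensorBimod
variable (K : Type*) {A V ι : Type*} [Field K] [Ring A] [Algebra K A]
variable [DecidableEq ι] [Fintype ι] (e : V → A) (l r : ι → V)

/-- The bimodule `A ⊗_S X* ⊗_S A`, for the dual basis of `X`, maps to the dual of `A ⊗_S X ⊗_S A`
through the pairing `⟨s, t⟩ = ∑ i, s i * swap (t i)` with values in the enveloping algebra. -/
def toDual : TensorBimod K e r l →ₗ[Env K A] Env.Dual K A (TensorBimod K e l r) where
  toFun t :=
    ({ toFun := fun s => ∑ i, (s i : Env K A) * Env.swap K (t i)
       map_add' := fun s s' => by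
        simp only [Pi.add_apply, Submodule.coe_add, add_mul, Finset.sum_add_distrib]
       map_smul' := fun c s => by
        simp only [Pi.smul_apply, Submodule.coe_smul, smul_eq_mul, mul_assoc, RingHom.id_apply,
          Finset.mul_sum] } : TensorBimod K e l r →ₗ[Env K A] Env K A)
  map_add' t t' := LinearMap.ext fun s => by
    change ∑ i, (s i : Env K A) * Env.swap K ((t i : Env K A) + (t' i : Env K A)) =
      ∑ i, (s i : Env K A) * Env.swap K (t i) + ∑ i, (s i : Env K A) * Env.swap K (t' i)
    simp only [Env.swap_add, mul_add, Finset.sum_add_distrib]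
  map_smul' c t := LinearMap.ext fun s => by
    change ∑ i, (s i : Env K A) * Env.swap K (c * (t i : Env K A)) =
      (∑ i, (s i : Env K A) * Env.swap K (t i)) * Env.swap K c
    simp only [Env.swap_mul, mul_assoc, Finset.sum_mul]

/-- The pairing of `A ⊗_S X ⊗_S A` with `A ⊗_S X* ⊗_S A`. -/
def pair (s : TensorBimod K e l r) (t : TensorBimod K e r l) : Env K A :=
  ∑ i, (s i : Env K A) * Env.swap K (t i)

theorem toDual_apply (t : TensorBimod K e r l) (s : TensorBimod K e l r) :
    DFunLike.coe (F := TensorBimod K e l r →ₗ[Env K A] Env K A) (toDual K e l r t) s =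
      pair K e l r s t := rfl

theorem gen_same (i : ι) : (gen K e l r i i : Env K A) = Env.tmul K (e (l i)) (e (r i)) := by
  rw [gen, Pi.single_eq_same]

theorem gen_ne {i j : ι} (h : j ≠ i) : (gen K e l r i j : Env K A) = 0 := by
  rw [gen, Pi.single_eq_of_ne h]; rfl

theorem tmul_mul_self (he : ∀ v, e v * e v = e v) (i : ι) :
    Env.tmul K (e (l i)) (e (r i)) * Env.tmul K (e (l i)) (e (r i)) =
      Env.tmul K (e (l i)) (e (r i)) := by
  rw [Env.tmul_mul_tmul, he, he]

theorem apply_mul (he : ∀ v, e v * e v = e v) (s : TensorBimod K e l r) (i : ι) :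
    (s i : Env K A) * Env.tmul K (e (l i)) (e (r i)) = s i := by
  obtain ⟨c, hc⟩ := Submodule.mem_span_singleton.mp (s i).2
  rw [← hc, smul_eq_mul, mul_assoc, tmul_mul_self K e l r he]

theorem pair_gen_left (he : ∀ v, e v * e v = e v) (i : ι) (t : TensorBimod K e r l) :
    pair K e l r (gen K e l r i) t = Env.swap K (t i) := by
  rw [pair, Finset.sum_eq_single i (fun j _ hj => by rw [gen_ne K e l r hj, zero_mul]) (by simp),
    gen_same, ← Env.swap_tmul, ← Env.swap_mul, apply_mul K e r l he]

theorem pair_gen_right (he : ∀ v, e v * e v = e v) (i : ι) (s : TensorBimod K e l r) :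
    pair K e l r s (gen K e r l i) = s i := by
  rw [pair, Finset.sum_eq_single i
      (fun j _ hj => by rw [gen_ne K e r l hj, Env.swap_zero, mul_zero]) (by simp),
    gen_same, Env.swap_tmul, apply_mul K e l r he]

theorem toDual_injective (he : ∀ v, e v * e v = e v) :
    Function.Injective (toDual K e l r) := by
  intro t t' h
  funext i
  have := congrArg (fun f => DFunLike.coe (F := TensorBimod K e l r →ₗ[Env K A] Env K A) f
    (gen K e l r i)) h
  simp only [toDual_apply, pair_gen_left K e l r he] at this
  rw [Subtype.ext_iff, ← Env.swap_swap K (t i : Env K A), this, Env.swap_swap]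

theorem gen_smul_self (he : ∀ v, e v * e v = e v) (i : ι) :
    Env.tmul K (e (l i)) (e (r i)) • gen K e l r i = gen K e l r i := by
  rw [gen, ← Pi.single_smul]
  congr 1
  exact Subtype.ext (tmul_mul_self K e l r he i)

theorem eq_sum_smul_gen (s : TensorBimod K e l r) :
    ∃ c : ι → Env K A, s = ∑ i, c i • gen K e l r i := by
  choose c hc using fun i => Submodule.mem_span_singleton.mp (s i).2
  refine ⟨c, funext fun i => Subtype.ext ?_⟩
  rw [Finset.sum_apply, Finset.sum_eq_single i, ← hc i]
  · exact congrArg (c i * ·) (gen_same K e l r i).symm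
  · intro j _ hj
    exact Subtype.ext ((congrArg (c j * ·) (gen_ne K e l r hj.symm)).trans (mul_zero _))
  · simp

theorem toDual_surjective (he : ∀ v, e v * e v = e v) :
    Function.Surjective (toDual K e l r) := by
  intro f
  change TensorBimod K e l r →ₗ[Env K A] Env K A at f
  refine ⟨fun i => ⟨Env.swap K (f (gen K e l r i)), ?_⟩, ?_⟩
  · rw [← gen_smul_self K e l r he, map_smul, smul_eq_mul, Env.swap_mul, Env.swap_tmul]
    exact Submodule.smul_mem _ _ (Submodule.mem_span_singleton_self _)
  · refine TensorBimod.hom_ext K e l r fun i => ?_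
    refine (toDual_apply K e l r _ _).trans ?_
    rw [pair_gen_left K e l r he]
    exact Env.swap_swap K _

/-- The pairing identifies `A ⊗_S X* ⊗_S A` with the dual of `A ⊗_S X ⊗_S A`. -/
def dualEquiv (he : ∀ v, e v * e v = e v) :
    TensorBimod K e r l ≃ₗ[Env K A] Env.Dual K A (TensorBimod K e l r) :=
  LinearEquiv.ofBijective (toDual K e l r)
    ⟨toDual_injective K e l r he, toDual_surjective K e l r he⟩

instance : Module.Finite (Env K A) (TensorBimod K e l r) := by
  have (i : ι) : Module.Finite (Env K A)
      ↥(Submodule.span (Env K A) {Env.tmul K (e (l i)) (e (r i))}) :=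
    Module.Finite.iff_fg.mpr (Submodule.fg_span_singleton _)
  infer_instance

theorem projective (he : ∀ v, e v * e v = e v) :
    Module.Projective (Env K A) (TensorBimod K e l r) := by
  have (i : ι) : Module.Projective (Env K A)
      ↥(Submodule.span (Env K A) {Env.tmul K (e (l i)) (e (r i))}) := by
    refine Module.Projective.of_split (Submodule.subtype _)
      (LinearMap.toSpanSingleton (Env K A) _
        ⟨Env.tmul K (e (l i)) (e (r i)), Submodule.mem_span_singleton_self _⟩) ?_
    refine LinearMap.ext fun s => Subtype.ext ?_
    obtain ⟨s, hs⟩ := s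
    obtain ⟨c, rfl⟩ := Submodule.mem_span_singleton.mp hs
    change (c * _) * _ = c * _
    rw [mul_assoc, tmul_mul_self K e l r he]
  exact Module.Projective.of_equiv (DFinsupp.linearEquivFunOnFintype (R := Env K A))

section Sub
variable (p : ι → Prop) [DecidablePred p]

/-- Restriction to the summands indexed by `i` with `p i`. -/
def restrict : TensorBimod K e l r →ₗ[Env K A]
    TensorBimod K e (fun i : {i // p i} => l i.1) (fun i => r i.1) where
  toFun s i := s i.1
  map_add' _ _ := rfl
  map_smul' _ _ := rfl

/-- Extension by zero from the summands indexed by `i` with `p i`. -/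
def extend : TensorBimod K e (fun i : {i // p i} => l i.1) (fun i => r i.1) →ₗ[Env K A]
    TensorBimod K e l r where
  toFun s i := if h : p i then s ⟨i, h⟩ else 0
  map_add' s s' := by
    funext i
    by_cases h : p i <;> simp [h]
  map_smul' c s := by
    funext i
    by_cases h : p i <;> simp [h]

theorem restrict_extend (s) : restrict K e l r p (extend K e l r p s) = s := by
  funext i
  exact dif_pos i.2

theorem extend_restrict_of_eq_zero (s : TensorBimod K e l r) (h : ∀ i, ¬ p i → s i = 0) :
    extend K e l r p (restrict K e l r p s) = s := by
  funext i
  by_cases hi : p i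
  · exact dif_pos hi
  · exact (dif_neg hi).trans (h i hi).symm

theorem pair_extend_right (s : TensorBimod K e l r) (t) :
    pair K e l r s (extend K e r l p t) =
      pair K e (fun i : {i // p i} => l i.1) (fun i => r i.1) (restrict K e l r p s) t := by
  rw [pair, pair, ← Finset.sum_filter_of_ne (p := p), Finset.sum_subtype _ (p := p) (by simp)]
  · refine Finset.sum_congr rfl fun i _ => ?_
    congr 3
    exact dif_pos i.2
  · intro i _ h
    by_contra hp
    refine h ?_
    rw [show extend K e r l p t i = 0 from dif_neg hp]
    exact (congrArg _ (Env.swap_zero K)).trans (mul_zero _)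

end Sub

theorem swap_pair (s : TensorBimod K e l r) (t : TensorBimod K e r l) :
    Env.swap K (pair K e l r s t) = pair K e r l t s := by
  have h (f : ι → Env K A) (u : Finset ι) :
      Env.swap K (∑ i ∈ u, f i) = ∑ i ∈ u, Env.swap K (f i) :=
    map_sum (AddMonoidHom.mk' (Env.swap K) (Env.swap_add K)) f u
  rw [pair, pair, h]
  exact Finset.sum_congr rfl fun i _ => by rw [Env.swap_mul, Env.swap_swap]

/-- The components of the element `x ⊗ i ⊗ y`. -/
theorem tens_apply (x : A) (i : ι) (y : A) (j : ι) :
    (tens K e l r x i y j : Env K A) =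
      if j = i then Env.tmul K (x * e (l i)) (e (r i) * y) else 0 := by
  rw [tens, Pi.smul_apply, Submodule.coe_smul, smul_eq_mul]
  split_ifs with h
  · rw [h, gen_same, Env.tmul_mul_tmul]
  · rw [gen_ne K e l r h, mul_zero]

end TensorBimod

namespace Env
variable (K : Type*) {A : Type*} [Field K] [Ring A] [Algebra K A]
variable {M N : Type*} [AddCommGroup M] [Module (Env K A) M] [AddCommGroup N] [Module (Env K A) N]

/-- The transpose of a homomorphism of bimodules. -/
def dualMap (φ : M →ₗ[Env K A] N) : Dual K A N →ₗ[Env K A] Dual K A M where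
  toFun f := LinearMap.comp (M₂ := N) f φ
  map_add' _ _ := rfl
  map_smul' _ _ := rfl

variable {P : Type*} [AddCommGroup P] [Module (Env K A) P]

theorem dualMap_comp_eq_zero (f : M →ₗ[Env K A] N) (g : N →ₗ[Env K A] P) (h : g ∘ₗ f = 0) :
    (-dualMap K f) ∘ₗ (-dualMap K g) = 0 := by
  refine LinearMap.ext fun (φ : P →ₗ[Env K A] Env K A) => LinearMap.ext fun m => ?_
  refine (neg_neg (φ (g (f m)))).trans ?_
  exact (congrArg φ (LinearMap.congr_fun h m)).trans (map_zero φ)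

end Env

namespace TensorBimod
variable {K : Type*} {A : Type*} {V ι : Type*} [Field K] [Ring A] [Algebra K A]
variable [DecidableEq ι] [Fintype ι] {e : V → A} (l r : ι → V)
variable (p q : ι → Prop) [DecidablePred p] [DecidablePred q]

theorem restrict_surjective : Function.Surjective (restrict K e l r p) :=
  fun s => ⟨_, restrict_extend K e l r p s⟩

theorem extend_injective : Function.Injective (extend K e l r p) :=
  Function.LeftInverse.injective (restrict_extend K e l r p)

/-- The complementary summands are the kernel of the restriction. -/
theorem exact_extend_restrict (h : ∀ i, p i ↔ ¬ q i) :
    Function.Exact (extend K e l r p) (restrict K e l r q) := by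
  intro s
  refine ⟨fun hs => ⟨_, extend_restrict_of_eq_zero K e l r p s fun i hi =>
    congrFun hs ⟨i, not_not.mp ((h i).not.mp hi)⟩⟩, ?_⟩
  rintro ⟨s, rfl⟩
  exact funext fun i => dif_neg fun hi => (h i).mp hi i.2

theorem exact_extend_neg_toDual_restrict (he : ∀ v, e v * e v = e v) (h : ∀ i, p i ↔ ¬ q i) :
    Function.Exact (extend K e l r p) (-(toDual K e (fun i : {i // q i} => r i.1)
      (fun i => l i.1) ∘ₗ restrict K e l r q)) := fun s =>
  (neg_eq_zero.trans (map_eq_zero_iff _ (toDual_injective K e _ _ he))).trans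
    (exact_extend_restrict l r p q h s)

theorem exact_toDual_extend_restrict (he : ∀ v, e v * e v = e v) (h : ∀ i, p i ↔ ¬ q i) :
    Function.Exact (toDual K e l r ∘ₗ extend K e r l p)
      (restrict K e r l q ∘ₗ (dualEquiv K e l r he).symm.toLinearMap) := by
  intro f
  obtain ⟨t, rfl⟩ := (dualEquiv K e l r he).surjective f
  have h1 : (restrict K e r l q ∘ₗ (dualEquiv K e l r he).symm.toLinearMap)
      (dualEquiv K e l r he t) = restrict K e r l q t :=
    congrArg (restrict K e r l q) ((dualEquiv K e l r he).symm_apply_apply t)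
  rw [h1, exact_extend_restrict r l p q h t]
  exact ⟨fun ⟨s, hs⟩ => ⟨s, congrArg (toDual K e l r) hs⟩,
    fun ⟨s, hs⟩ => ⟨s, toDual_injective K e l r he hs⟩⟩

theorem restrict_comp_dualEquiv_symm_surjective (he : ∀ v, e v * e v = e v) :
    Function.Surjective (restrict K e r l q ∘ₗ (dualEquiv K e l r he).symm.toLinearMap) :=
  (restrict_surjective r l q).comp (dualEquiv K e l r he).symm.surjective

end TensorBimod

/-! ### Cutting cyclic words -/

section SplitSum
variable {E M : Type*} [DecidableEq E] [AddCommMonoid M]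

/-- The sum of `H u v` over all decompositions `l = u ++ β :: v`. -/
def splitSum (β : E) : (List E → List E → M) → List E → M
  | _, [] => 0
  | H, γ :: l => (if γ = β then H [] l else 0) + splitSum β (fun u v => H (γ :: u) v) l

theorem splitSum_eq_sum (β : E) (H : List E → List E → M) (l : List E) :
    splitSum β H l = ∑ i : Fin l.length, if l[i] = β then H (l.take i) (l.drop (i + 1)) else 0 := by
  induction l generalizing H with
  | nil => rfl
  | cons γ l ih =>
    rw [splitSum, ih]
    refine Eq.trans ?_ (Fin.sum_univ_succ (n := l.length) _).symm
    rfl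

theorem splitSum_add (β : E) (H H' : List E → List E → M) (l : List E) :
    splitSum β (fun u v => H u v + H' u v) l = splitSum β H l + splitSum β H' l := by
  simp only [splitSum_eq_sum, ← Finset.sum_add_distrib]
  exact Finset.sum_congr rfl fun i _ => by split_ifs <;> simp

theorem splitSum_append (β : E) (H : List E → List E → M) (l m : List E) :
    splitSum β H (l ++ m) =
      splitSum β (fun u v => H u (v ++ m)) l + splitSum β (fun u v => H (l ++ u) v) m := by
  induction l generalizing H with
  | nil => simp [splitSum]
  | cons γ l ih => simp only [List.cons_append, splitSum, ih, add_assoc]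

theorem map_splitSum {N : Type*} [AddCommMonoid N] (f : M →+ N) (β : E)
    (H : List E → List E → M) (l : List E) :
    f (splitSum β H l) = splitSum β (fun u v => f (H u v)) l := by
  simp only [splitSum_eq_sum, map_sum, apply_ite f, map_zero]

/-- Both sides sum over the decompositions `l = u ++ α :: v ++ β :: w`. -/
theorem splitSum_splitSum (α β : E) (H : List E → List E → List E → M) (l : List E) :
    splitSum α (fun u d => splitSum β (fun v w => H u v w) d) l =
      splitSum β (fun c w => splitSum α (fun u v => H u v w) c) l := by
  induction l generalizing H with
  | nil => rfl
  | cons γ l ih =>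
    simp only [splitSum, splitSum_add, ih, ite_self, zero_add]
    congr 1
    split_ifs
    · rfl
    · rw [splitSum_eq_sum]; simp

/-- The second cyclic derivatives are symmetric: both sides sum over the ways to cut the cyclic word
`l` at an occurrence of `α` and at another one of `β`, into the word that follows `α` and the word
that follows `β`. -/
theorem splitSum_cyclic (α β : E) (G : List E → List E → M) (l : List E) :
    splitSum α (fun u v => splitSum β G (v ++ u)) l =
      splitSum β (fun u v => splitSum α (fun x y => G y x) (v ++ u)) l := by
  simp only [splitSum_append, splitSum_add]
  rw [splitSum_splitSum α β (fun u v w => G v (w ++ u)),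
    ← splitSum_splitSum β α (fun u v w => G (w ++ u) v), add_comm]

end SplitSum

/-! ### Self-duality of the differentials -/

namespace IceQuiver
open TensorBimod
variable {V E : Type*} {Q : IceQuiver V E} {K A : Type*} [Field K] [Ring A] [Algebra K A]
  {e : V → A} {a : E → A} [DecidableEq V] [DecidableEq E]

variable [Fintype V] [Fintype E]

theorem mu₃_gen_apply (h : Q.IsRep e a) (v : Q.MutableVertex) (α : Q.MutableArrow) :
    (Q.mu₃ K e a (gen K e _ _ v) α : Env K A) =
      (if Q.src α.1 = v.1 then Env.tmul K (e (Q.src α.1)) (a α.1) else 0) -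
        if Q.tgt α.1 = v.1 then Env.tmul K (a α.1) (e (Q.tgt α.1)) else 0 := by
  rw [mu₃, lift_gen, Pi.smul_apply, Pi.sub_apply, Finset.sum_apply, Finset.sum_apply,
    Finset.sum_eq_single α, Finset.sum_eq_single α, Submodule.coe_smul, Submodule.coe_sub,
    smul_eq_mul, mul_sub]
  · congr 1
    · split_ifs with hv
      · rw [t₂, tens_apply, if_pos rfl, Env.tmul_mul_tmul, ← hv, one_mul, h.idem, h.left, h.right]
      · exact mul_zero _
    · split_ifs with hv
      · rw [t₂, tens_apply, if_pos rfl, Env.tmul_mul_tmul, ← hv, mul_one, h.idem, h.right, h.left]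
      · exact mul_zero _
  · intro β _ hβ
    split_ifs
    · exact Subtype.ext (by rw [t₂, tens_apply, if_neg hβ.symm]; rfl)
    · rfl
  · simp
  · intro β _ hβ
    split_ifs
    · exact Subtype.ext (by rw [t₂, tens_apply, if_neg hβ.symm]; rfl)
    · rfl
  · simp

theorem mu₁_gen_apply (h : Q.IsRep e a) (α : E) (v : V) :
    (Q.mu₁ K e a (gen K e _ _ α) v : Env K A) =
      (if Q.tgt α = v then Env.tmul K (e (Q.tgt α)) (a α) else 0) -
        if Q.src α = v then Env.tmul K (a α) (e (Q.src α)) else 0 := by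
  rw [mu₁, lift_gen, Pi.smul_apply, Pi.sub_apply, Submodule.coe_smul, Submodule.coe_sub,
    smul_eq_mul, mul_sub, tens_apply, tens_apply]
  congr 1
  · simp only [eq_comm (a := v)]
    split_ifs with hv
    · rw [Env.tmul_mul_tmul, id, one_mul, h.idem, h.left, h.right]
    · exact mul_zero _
  · simp only [eq_comm (a := v)]
    split_ifs with hv
    · rw [Env.tmul_mul_tmul, id, mul_one, h.idem, h.right, h.left]
    · exact mul_zero _

/-- The components of the noncommutative derivative `Δ_β p`. -/
theorem Delta_apply (p : List E) (β : E) :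
    (Q.Delta K e a p β : Env K A) =
      splitSum β (fun u v =>
        Env.tmul K (pathProd a u * e (Q.tgt β)) (e (Q.src β) * pathProd a v)) p := by
  rw [Delta, Finset.sum_apply, splitSum_eq_sum, AddSubmonoidClass.coe_finsetSum]
  refine Finset.sum_congr rfl fun i _ => ?_
  rw [tens_apply]
  by_cases hβ : p[i] = β
  · rw [if_pos hβ.symm, if_pos hβ, hβ]
  · rw [if_neg (Ne.symm hβ), if_neg hβ]

/-- The matrix entry of `mu₂` at `α` and `β` is the second derivative of `W`: cut each cycle at an
occurrence of `α` and then at one of `β`. -/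
theorem mu₂_gen_apply (W : Q.Potential K) (α : Q.MutableArrow) (β : E) :
    (Q.mu₂ K e a W (gen K e _ _ α) β : Env K A) =
      W.sum fun l c => c • splitSum α.1 (fun x y => splitSum β (fun u v =>
        Env.tmul K (e (Q.src α.1) * (pathProd a u * e (Q.tgt β)))
          (e (Q.src β) * pathProd a v * e (Q.tgt α.1))) (y ++ x)) l.1 := by
  rw [mu₂, lift_gen, DeltaLin, linearCombination_cyclicDerivative, Finsupp.sum, Finsupp.sum,
    Pi.smul_apply, Finset.sum_apply, Submodule.coe_smul, AddSubmonoidClass.coe_finsetSum,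
    Finset.smul_sum]
  refine Finset.sum_congr rfl fun l _ => ?_
  rw [splitSum_eq_sum, Finset.sum_apply, AddSubmonoidClass.coe_finsetSum, Finset.smul_sum,
    Finset.smul_sum]
  refine Finset.sum_congr rfl fun i _ => ?_
  split_ifs with hi
  · rw [Pi.smul_apply]
    change Env.tmul K (e (Q.src α.1)) (e (Q.tgt α.1)) * (W l • (Q.Delta K e a _ β : Env K A)) = _
    rw [mul_smul_comm, Delta_apply]
    congr 1
    refine (map_splitSum (AddMonoidHom.mulLeft _) _ _ _).trans ?_
    congr 1
    funext u v
    exact Env.tmul_mul_tmul K (A := A) _ _ _ _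
  · rw [smul_zero]
    exact mul_zero _

/-- The matrix of `mu₂` between mutable arrows is symmetric up to `swap`, by the symmetry of the
second derivatives of the potential. -/
theorem swap_mu₂_gen_apply (W : Q.Potential K) (α β : Q.MutableArrow) :
    Env.swap K (Q.mu₂ K e a W (gen K e _ _ α) β.1 : Env K A) =
      Q.mu₂ K e a W (gen K e _ _ β) α.1 := by
  rw [mu₂_gen_apply, mu₂_gen_apply]
  refine (map_finsuppSum (AddMonoidHom.mk' (Env.swap K) (Env.swap_add K)) W _).trans ?_
  refine Finsupp.sum_congr fun l _ => ?_
  have hs (c : K) (r : Env K A) : Env.swap K (c • r) = c • Env.swap K r :=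
    congrArg unop (map_smul (Env.flip K A) c r)
  refine (hs _ _).trans (congrArg _ ?_)
  rw [splitSum_cyclic]
  refine (map_splitSum (AddMonoidHom.mk' (Env.swap K) (Env.swap_add K)) _ _ _).trans ?_
  congr 1
  funext x y
  refine (map_splitSum (AddMonoidHom.mk' (Env.swap K) (Env.swap_add K)) _ _ _).trans ?_
  congr 1
  funext u v
  refine (Env.swap_tmul K _ _).trans ?_
  rw [mul_assoc, mul_assoc]

variable (K e Q)

/-- The projection `P₁ ⟶ P₂*` onto the summands of mutable arrows, with a sign. -/
def phi₁ : Q.P₁ K e →ₗ[Env K A] Env.Dual K A (Q.P₂ K e) :=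
  -(toDual K e (fun α : Q.MutableArrow => Q.src α.1) (fun α => Q.tgt α.1) ∘ₗ
    restrict K e Q.tgt Q.src (fun α => α ∉ Q.frozenE))

/-- The projection `P₀ ⟶ P₃*` onto the summands of mutable vertices, with a sign. -/
def phi₀ : P₀ K e →ₗ[Env K A] Env.Dual K A (Q.P₃ K e) :=
  -(toDual K e (fun v : Q.MutableVertex => v.1) (fun v => v.1) ∘ₗ
    restrict K e id id (fun v => v ∉ Q.frozenV))

/-- The inclusion `P₂ ⟶ P₁*` of the summands of mutable arrows. -/
def phi₂ : Q.P₂ K e →ₗ[Env K A] Env.Dual K A (Q.P₁ K e) :=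
  toDual K e Q.tgt Q.src ∘ₗ extend K e Q.src Q.tgt (fun α => α ∉ Q.frozenE)

/-- The inclusion `P₃ ⟶ P₀*` of the summands of mutable vertices. -/
def phi₃ : Q.P₃ K e →ₗ[Env K A] Env.Dual K A (P₀ K e) :=
  toDual K e id id ∘ₗ extend K e id id (fun v => v ∉ Q.frozenV)

variable {K e Q}

/-- Between mutable vertices and arrows, `mu₁` and `mu₃` are transposes of each other. -/
theorem phi₀_comp_mu₁ (h : Q.IsRep e a) :
    phi₀ Q K e ∘ₗ Q.mu₁ K e a = -(Env.dualMap K (Q.mu₃ K e a) ∘ₗ phi₁ Q K e) := by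
  refine TensorBimod.hom_ext K e _ _ fun α => TensorBimod.hom_ext K e _ _ fun v => ?_
  have hl : DFunLike.coe (F := Q.P₃ K e →ₗ[Env K A] Env K A)
      ((phi₀ Q K e ∘ₗ Q.mu₁ K e a) (gen K e _ _ α)) (gen K e _ _ v) =
      -Env.swap K (Q.mu₁ K e a (gen K e _ _ α) v.1) :=
    congrArg Neg.neg (pair_gen_left K e _ _ h.idem v _)
  have hr : DFunLike.coe (F := Q.P₃ K e →ₗ[Env K A] Env K A)
      ((-(Env.dualMap K (Q.mu₃ K e a) ∘ₗ phi₁ Q K e)) (gen K e _ _ α)) (gen K e _ _ v) =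
      pair K e (fun α : Q.MutableArrow => Q.src α.1) (fun α => Q.tgt α.1)
        (Q.mu₃ K e a (gen K e _ _ v))
        (restrict K e Q.tgt Q.src (fun α => α ∉ Q.frozenE) (gen K e _ _ α)) :=
    neg_neg _
  refine hl.trans (Eq.trans ?_ hr.symm)
  have hsub (r s : Env K A) : Env.swap K (r - s) = Env.swap K r - Env.swap K s :=
    map_sub (AddMonoidHom.mk' (Env.swap K) (Env.swap_add K)) r s
  rw [mu₁_gen_apply h, hsub, neg_sub, apply_ite (Env.swap K), apply_ite (Env.swap K),
    Env.swap_zero, Env.swap_tmul, Env.swap_tmul]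
  -- a frozen arrow has no mutable end, so both sides vanish on it
  by_cases hα : α ∉ Q.frozenE
  · have : restrict K e Q.tgt Q.src (fun α => α ∉ Q.frozenE) (gen K e _ _ α) =
        gen K e _ _ ⟨α, hα⟩ := by
      funext β
      by_cases hβ : β = ⟨α, hα⟩
      · subst hβ
        exact Subtype.ext ((gen_same K e _ _ α).trans (gen_same K e (fun α : Q.MutableArrow =>
          Q.tgt α.1) (fun α => Q.src α.1) ⟨α, hα⟩).symm)
      · refine Subtype.ext ((gen_ne K e _ _ fun hβ' => hβ (Subtype.ext hβ')).trans
          (gen_ne K e _ _ hβ).symm)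
    rw [this, pair_gen_right K e _ _ h.idem, mu₃_gen_apply h]
  · have : restrict K e Q.tgt Q.src (fun α => α ∉ Q.frozenE) (gen K e _ _ α) = 0 := by
      funext β
      exact Subtype.ext (gen_ne K e _ _ fun hβ => hα (hβ ▸ β.2))
    have h0 (s) : pair K e (fun α : Q.MutableArrow => Q.src α.1) (fun α => Q.tgt α.1) s 0 = 0 :=
      Finset.sum_eq_zero fun i _ => (congrArg _ (Env.swap_zero K)).trans (mul_zero _)
    rw [this, h0, if_neg fun hv : Q.src α = v => v.2 (hv ▸ Q.src_mem α (not_not.mp hα)),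
      if_neg fun hv : Q.tgt α = v => v.2 (hv ▸ Q.tgt_mem α (not_not.mp hα)), sub_zero]

/-- The transpose of `phi₀_comp_mu₁`. -/
theorem phi₂_comp_mu₃ (h : Q.IsRep e a) :
    phi₂ Q K e ∘ₗ Q.mu₃ K e a = -(Env.dualMap K (Q.mu₁ K e a) ∘ₗ phi₃ Q K e) := by
  refine LinearMap.ext fun w => LinearMap.ext fun s => ?_
  have hneg (r : Env K A) : Env.swap K (-r) = -Env.swap K r :=
    map_neg (AddMonoidHom.mk' (Env.swap K) (Env.swap_add K)) r
  have key : -pair K e (fun v : Q.MutableVertex => v.1) (fun v => v.1) w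
        (restrict K e id id (fun v => v ∉ Q.frozenV) (Q.mu₁ K e a s)) =
      - -pair K e (fun α : Q.MutableArrow => Q.src α.1) (fun α => Q.tgt α.1) (Q.mu₃ K e a w)
        (restrict K e Q.tgt Q.src (fun α => α ∉ Q.frozenE) s) :=
    congrArg (fun f => DFunLike.coe (F := Q.P₃ K e →ₗ[Env K A] Env K A) (f s) w)
      (phi₀_comp_mu₁ h)
  have hl : pair K e _ _ s (extend K e Q.src Q.tgt (fun α => α ∉ Q.frozenE) (Q.mu₃ K e a w)) =
      -pair K e _ _ (Q.mu₁ K e a s) (extend K e id id (fun v => v ∉ Q.frozenV) w) := by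
    rw [neg_neg] at key
    rw [pair_extend_right, pair_extend_right]
    refine (swap_pair K e _ _ _ _).symm.trans ((congrArg (Env.swap K) key.symm).trans ?_)
    exact (hneg _).trans (congrArg Neg.neg (swap_pair K e _ _ _ _))
  exact hl

/-- Between mutable arrows, `mu₂` is its own transpose. -/
theorem phi₁_comp_mu₂ (h : Q.IsRep e a) (W : Q.Potential K) :
    phi₁ Q K e ∘ₗ Q.mu₂ K e a W = -(Env.dualMap K (Q.mu₂ K e a W) ∘ₗ phi₂ Q K e) := by
  refine TensorBimod.hom_ext K e _ _ fun α => TensorBimod.hom_ext K e _ _ fun β => ?_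
  refine congrArg Neg.neg (?_ : pair K e _ _ (gen K e _ _ β)
    (restrict K e Q.tgt Q.src (fun α => α ∉ Q.frozenE) (Q.mu₂ K e a W (gen K e _ _ α))) =
    pair K e _ _ (Q.mu₂ K e a W (gen K e _ _ β))
      (extend K e Q.src Q.tgt (fun α => α ∉ Q.frozenE) (gen K e _ _ α)))
  rw [pair_extend_right, pair_gen_left K e _ _ h.idem, pair_gen_right K e _ _ h.idem]
  exact swap_mu₂_gen_apply W α β

end IceQuiver

/-! ### Null-homotopic maps and orthogonality -/

section Nullhomotopic
open CochainComplex HomComplex Limits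
variable {C : Type*} [Category C] [Preadditive C] {Z Y : CochainComplex C ℤ}

/-- The homotopy of `nonempty_homotopy_zero`, as far as the degrees above `b - m`. -/
theorem exists_partial_homotopy (g : Z ⟶ Y) (b : ℤ) (hb : ∀ n, b < n → IsZero (Z.X n))
    (H : ∀ n, ∀ u : Z.X n ⟶ Y.X n, u ≫ Y.d n (n + 1) = 0 →
      ∃ k : Z.X n ⟶ Y.X (n - 1), k ≫ Y.d (n - 1) n = u) (m : ℕ) :
    ∃ h : Cochain Z Y (-1), ∀ n, b - m < n → (δ (-1) 0 h).v n n (add_zero n) = g.f n := by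
  induction m with
  | zero => exact ⟨0, fun n hn => (hb n (by simpa using hn)).eq_of_src _ _⟩
  | succ m ih =>
    obtain ⟨h, hh⟩ := ih
    set n₀ : ℤ := b - m with hn₀
    have hδ (z : Cochain Z Y (-1)) (p n : ℤ) (hp : p = n - 1) : (δ (-1) 0 z).v n n (add_zero n) =
        z.v n p (by lia) ≫ Y.d p n + Z.d n (n + 1) ≫ z.v (n + 1) n (by lia) := by
      rw [δ_v (-1) 0 (by lia) z n n (add_zero n) p (n + 1) hp rfl, Int.negOnePow_zero, one_smul]
    -- the error term in degree `n₀` takes values in cycles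
    obtain ⟨k, hk⟩ := H n₀ (g.f n₀ - (δ (-1) 0 h).v n₀ n₀ (add_zero n₀)) (by
      have := hδ h n₀ (n₀ + 1) (by lia)
      rw [hh (n₀ + 1) (by lia)] at this
      rw [Preadditive.sub_comp, g.comm, this, hδ h _ _ rfl]
      simp)
    refine ⟨h + Cochain.single k (-1), fun n hn => ?_⟩
    rw [δ_add, Cochain.add_v, hδ (Cochain.single k (-1)) _ _ rfl, Cochain.single_v_eq_zero k (-1)
      (n + 1) n (by lia) (by lia), comp_zero, add_zero]
    by_cases hn' : n = n₀
    · subst hn'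
      rw [Cochain.single_v, hk, add_sub_cancel]
    · rw [Cochain.single_v_eq_zero k (-1) n _ _ hn', zero_comp, add_zero, hh n (by lia)]

/-- A morphism from a bounded complex is null-homotopic if all morphisms from its terms to cycles of
the target lift to boundaries; the homotopy is built by descending induction on the degree. -/
theorem nonempty_homotopy_zero (g : Z ⟶ Y) (a b : ℤ) (ha : ∀ n, n < a → IsZero (Z.X n))
    (hb : ∀ n, b < n → IsZero (Z.X n))
    (H : ∀ n, ∀ u : Z.X n ⟶ Y.X n, u ≫ Y.d n (n + 1) = 0 →
      ∃ k : Z.X n ⟶ Y.X (n - 1), k ≫ Y.d (n - 1) n = u) : Nonempty (Homotopy g 0) := by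
  obtain ⟨h, hh⟩ := exists_partial_homotopy g b hb H (b - a + 1).toNat
  refine ⟨(Cochain.equivHomotopy g 0).symm ⟨h, ?_⟩⟩
  ext n
  rw [Cochain.ofHom_v, Cochain.ofHom_zero, add_zero]
  by_cases hn : n < a
  · exact (ha n hn).eq_of_src _ _
  · exact (hh n (by lia)).symm

end Nullhomotopic

section Orthogonal
variable {B : Type v} [Ring B]

/-- The complexes whose cohomology is annihilated by `e`. -/
def cohomologyKilledBy (e : B) : ObjectProperty (DerivedCategory (ModuleCat.{v} B)) := fun M =>
  ∀ (i : ℤ) (x : (DerivedCategory.homologyFunctor (ModuleCat.{v} B) i).obj M), e • x = 0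

theorem smul_eq_zero_of_iso {M N : ModuleCat.{v} B} (φ : M ≅ N) (e : B) (h : ∀ x : M, e • x = 0)
    (y : N) : e • y = 0 := by
  have : y = φ.hom (φ.inv y) := by simp
  rw [this, ← map_smul, h, map_zero]

instance (e : B) : (cohomologyKilledBy e).IsClosedUnderIsomorphisms where
  of_iso φ h i := smul_eq_zero_of_iso ((DerivedCategory.homologyFunctor _ i).mapIso φ) e (h i)

instance (e : B) : (cohomologyKilledBy e).IsStableUnderShift ℤ where
  isStableUnderShiftBy n := ⟨fun M hM i => smul_eq_zero_of_iso
    (((DerivedCategory.homologyFunctor (ModuleCat.{v} B) 0).shiftIso n i (n + i) rfl).app M).symm e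
      (hM (n + i))⟩

/-- A bounded complex of projectives whose terms admit no nonzero map to a module annihilated by `e`
is orthogonal to the complexes whose cohomology is annihilated by `e`: a cocycle of such a map has
zero class in cohomology, so it lifts to a boundary. -/
theorem leftOrthogonal_of_bounded (e : B) (Z : CochainComplex (ModuleCat.{v} B) ℤ) (a b : ℤ)
    (ha : ∀ n, n < a → Limits.IsZero (Z.X n)) (hb : ∀ n, b < n → Limits.IsZero (Z.X n))
    (hp : ∀ n, Projective (Z.X n))
    (hg : ∀ n (H : ModuleCat.{v} B), (∀ x : H, e • x = 0) → ∀ u : Z.X n ⟶ H, u = 0) :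
    (cohomologyKilledBy e).leftOrthogonal (DerivedCategory.Q.obj Z) := by
  intro M f hM
  -- a morphism out of `Z` in the derived category is a morphism of complexes followed by the
  -- inverse of a quasi-isomorphism
  obtain ⟨Y, ⟨φ⟩⟩ : ∃ Y, Nonempty (DerivedCategory.Q.obj Y ≅ M) :=
    ⟨_, ⟨DerivedCategory.Q.objObjPreimageIso M⟩⟩
  obtain ⟨Y', g, s, hs, hf⟩ := DerivedCategory.left_fac (f ≫ φ.inv)
  have hY' (n : ℤ) (x : Y'.homology n) : e • x = 0 :=
    smul_eq_zero_of_iso ((DerivedCategory.homologyFunctorFactors (ModuleCat.{v} B) n).app Y') e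
      ((cohomologyKilledBy e).prop_of_iso (φ.symm ≪≫ asIso (DerivedCategory.Q.map s)) hM n) x
  obtain ⟨h⟩ := nonempty_homotopy_zero g a b ha hb fun n u hu => by
    have hex : (ShortComplex.mk _ _ (Y'.toCycles_comp_homologyπ (n - 1) n)).Exact :=
      ShortComplex.exact_of_g_is_cokernel _ (Y'.homologyIsCokernel (n - 1) n (by simp))
    have h0 : Y'.liftCycles u (n + 1) (by simp) hu ≫ Y'.homologyπ n = 0 := hg n _ (hY' n) _
    have := hp n
    refine ⟨hex.liftFromProjective _ h0, ?_⟩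
    have h1 := hex.liftFromProjective_comp _ h0
    rw [← Y'.toCycles_i, ← Category.assoc]
    exact (congrArg (· ≫ Y'.iCycles n) h1).trans (Y'.liftCycles_i _ _ _ _)
  rw [← cancel_mono φ.inv, hf, DerivedCategory.Q_map_eq_of_homotopy _ h, Functor.map_zero,
    Limits.zero_comp, Limits.zero_comp]

end Orthogonal

section Restrict

theorem projective_of_tower (B R M : Type*) [Ring B] [Ring R] [AddCommGroup M] [Module B R]
    [Module R M] [Module B M] [IsScalarTower B R M] [IsScalarTower B R R] [Module.Projective B R]
    [Module.Projective R M] : Module.Projective B M := by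
  obtain ⟨s, hs⟩ := Module.projective_def.mp ‹Module.Projective R M›
  classical
  have : Module.Projective B (M →₀ R) :=
    Module.Projective.of_equiv (finsuppLequivDFinsupp (ι := M) (M := R) B).symm
  exact Module.Projective.of_split (s.restrictScalars B)
    ((Finsupp.linearCombination R id).restrictScalars B) (LinearMap.ext hs)

variable {B R : Type v} [Ring B] [Ring R] (f : B →+* R)

theorem projective_restrictScalars
    (hf : Module.Projective B ((ModuleCat.restrictScalars.{v} f).obj (ModuleCat.of R R)))
    (M : ModuleCat.{v} R) [Module.Projective R M] :
    Projective ((ModuleCat.restrictScalars.{v} f).obj M) := by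
  let : Module B R := Module.compHom R f
  let : Module B M := Module.compHom M f
  have : IsScalarTower B R M := ⟨fun x y z => mul_smul (f x) y z⟩
  have : IsScalarTower B R R := ⟨fun x y z => mul_smul (f x) y z⟩
  have : Module.Projective B R := hf
  exact (IsProjective.iff_projective ((ModuleCat.restrictScalars.{v} f).obj M)).mp
    (projective_of_tower B R M)

/-- The module `M` is projective, and generated by the elements `ε • m`. -/
structure IsGeneratedProjective (ε : R) (M : ModuleCat.{v} R) : Prop where
  projective : Module.Projective R M
  span : Submodule.span R (Set.range fun m : M => ε • m) = ⊤

/-- A module over `R` that is generated by the elements `ε • m` has, as a module over `B`, no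
nonzero map to a module annihilated by `e`, since every `r * ε` is a sum of elements of `B e R`. -/
theorem restrictScalars_hom_eq_zero {e : B} {ε : R}
    (h : ∀ r : R, r * ε ∈ AddSubmonoid.closure {x | ∃ b s, x = f b * f e * s})
    {M : ModuleCat.{v} R} (hM : IsGeneratedProjective ε M) (H : ModuleCat.{v} B)
    (hH : ∀ x : H, e • x = 0) (u : (ModuleCat.restrictScalars.{v} f).obj M ⟶ H) : u = 0 := by
  let w : M →+ H := u.hom.toAddMonoidHom
  have hw (b : B) (m : M) : w (f b • m) = b • w m := u.hom.map_smul b m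
  have key (r : R) (hr : r ∈ AddSubmonoid.closure {x | ∃ b s, x = f b * f e * s}) (m : M) :
      w (r • m) = 0 := by
    induction hr using AddSubmonoid.closure_induction with
    | mem x hx =>
      obtain ⟨b, s, rfl⟩ := hx
      rw [mul_smul, mul_smul, hw, hw, hH, smul_zero]
    | zero => rw [zero_smul, map_zero]
    | add x y _ _ hx hy => rw [add_smul, map_add, hx, hy, add_zero]
  suffices hw0 : ∀ m : M, w m = 0 from ModuleCat.hom_ext (LinearMap.ext hw0)
  intro m
  have hm : m ∈ Submodule.span R (Set.range fun m : M => ε • m) := by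
    rw [hM.span]; exact Submodule.mem_top
  induction hm using Submodule.closure_induction with
  | zero => exact map_zero w
  | add x y _ _ hx hy => rw [map_add, hx, hy, add_zero]
  | smul_mem r x hx =>
    obtain ⟨m, rfl⟩ := hx
    change w (r • ε • m) = 0
    rw [← mul_smul]
    exact key _ (h r) m

/-- The case of `leftOrthogonal_of_bounded` for the restriction along `f : B →+* R` of a complex of
modules over `R`. -/
theorem leftOrthogonal_map_of_bounded
    (hf : Module.Projective B ((ModuleCat.restrictScalars.{v} f).obj (ModuleCat.of R R)))
    {e : B} {ε : R} (h : ∀ r : R, r * ε ∈ AddSubmonoid.closure {x | ∃ b s, x = f b * f e * s})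
    (Z : CochainComplex (ModuleCat.{v} R) ℤ) (a b : ℤ)
    (ha : ∀ n, n < a → Limits.IsZero (Z.X n)) (hb : ∀ n, b < n → Limits.IsZero (Z.X n))
    (hZ : ∀ n, IsGeneratedProjective ε (Z.X n)) :
    ((cohomologyKilledBy e).leftOrthogonal.inverseImage
      (ModuleCat.restrictScalars.{v} f).mapDerivedCategory) (DerivedCategory.Q.obj Z) := by
  refine (cohomologyKilledBy e).leftOrthogonal.prop_of_iso
    ((ModuleCat.restrictScalars.{v} f).mapDerivedCategoryFactors.app Z).symm ?_
  refine leftOrthogonal_of_bounded e _ a b (fun n hn => ?_) (fun n hn => ?_) (fun n => ?_)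
    fun n H hH u => restrictScalars_hom_eq_zero f h (hZ n) H hH u
  · exact (ModuleCat.restrictScalars.{v} f).map_isZero (ha n hn)
  · exact (ModuleCat.restrictScalars.{v} f).map_isZero (hb n hn)
  · have := (hZ n).projective
    exact projective_restrictScalars f hf (Z.X n)

end Restrict

section
universe w
variable {K : Type u} {R : Type w} [Field K] [Ring R] [Algebra K R]

/-- The cohomology of the objects that `IsFiniteDimSupported` describes is annihilated by `e`. -/
theorem rHomVanishes_of_leftOrthogonal {e : R} {C M : DerivedCategory (ModuleCat.{w} R)}
    (hC : (cohomologyKilledBy e).leftOrthogonal C) (hM : IsFiniteDimSupported K e M) :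
    RHomVanishes C M := fun i f =>
  hC f ((cohomologyKilledBy e).le_shift i _ fun n =>
    hM.1 n e (TwoSidedIdeal.subset_span rfl))

end

/-! ### Extended complexes and their cones -/

namespace IsGeneratedProjective
variable {R : Type v} [Ring R] {ε : R}

theorem of_linearEquiv {M N : ModuleCat.{v} R} (hM : IsGeneratedProjective ε M) (φ : M ≃ₗ[R] N) :
    IsGeneratedProjective ε N where
  projective := by
    have := hM.projective
    exact Module.Projective.of_equiv φ
  span := by
    have h := congrArg (Submodule.map φ.toLinearMap) hM.span
    rw [Submodule.map_span, Submodule.map_top, LinearEquiv.range] at h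
    rw [← h]
    congr 1
    ext y
    constructor
    · rintro ⟨n, rfl⟩
      exact ⟨_, ⟨φ.symm n, rfl⟩, by simp⟩
    · rintro ⟨_, ⟨m, rfl⟩, rfl⟩
      exact ⟨φ m, by simp⟩

theorem of_iso {M N : ModuleCat.{v} R} (hM : IsGeneratedProjective ε M) (φ : M ≅ N) :
    IsGeneratedProjective ε N := hM.of_linearEquiv φ.toLinearEquiv

theorem of_isZero {M : ModuleCat.{v} R} (hM : Limits.IsZero M) : IsGeneratedProjective ε M := by
  have := ModuleCat.subsingleton_of_isZero hM
  have := Module.Free.of_subsingleton R M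
  exact ⟨.of_free, Subsingleton.elim _ _⟩

theorem kernel_of_exact {L M N : Type v} [AddCommGroup L] [Module R L] [AddCommGroup M] [Module R M]
    [AddCommGroup N] [Module R N] (i : L →ₗ[R] M) (f : M →ₗ[R] N) (hi : Function.Injective i)
    (h : Function.Exact i f) (hL : IsGeneratedProjective ε (ModuleCat.of R L)) :
    IsGeneratedProjective ε (Limits.kernel (ModuleCat.ofHom f)) :=
  (hL.of_linearEquiv (N := ModuleCat.of R (LinearMap.ker f)) (LinearEquiv.ofInjective i hi ≪≫ₗ
    LinearEquiv.ofEq _ _ h.linearMap_ker_eq.symm)).of_iso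
      (ModuleCat.kernelIsoKer (ModuleCat.ofHom f)).symm

theorem cokernel_of_exact {L M N : Type v} [AddCommGroup L] [Module R L] [AddCommGroup M]
    [Module R M] [AddCommGroup N] [Module R N] (f : M →ₗ[R] N) (g : N →ₗ[R] L)
    (hg : Function.Surjective g) (h : Function.Exact f g)
    (hL : IsGeneratedProjective ε (ModuleCat.of R L)) :
    IsGeneratedProjective ε (Limits.cokernel (ModuleCat.ofHom f)) :=
  (hL.of_linearEquiv (N := ModuleCat.of R (N ⧸ LinearMap.range f))
    ((Submodule.quotEquivOfEq _ _ h.linearMap_ker_eq.symm ≪≫ₗ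
      g.quotKerEquivOfSurjective hg).symm)).of_iso
      (ModuleCat.cokernelIsoRangeQuotient (ModuleCat.ofHom f)).symm

end IsGeneratedProjective

section Extend
open Limits ComplexShape
variable {R : Type v} [Ring R] {ε : R} {X Y : ChainComplex (ModuleCat.{v} R) ℕ} (φ : X ⟶ Y)

theorem isGeneratedProjective_kernel_extendMap
    (h : ∀ k, IsGeneratedProjective ε (kernel (φ.f k))) (n : ℤ) :
    IsGeneratedProjective ε ((kernel (HomologicalComplex.extendMap φ embeddingDownNat)).X n) := by
  have e₁ := PreservesKernel.iso (HomologicalComplex.eval _ _ n)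
    (HomologicalComplex.extendMap φ embeddingDownNat)
  refine IsGeneratedProjective.of_iso ?_ e₁.symm
  by_cases hn : ∃ k, embeddingDownNat.f k = n
  · obtain ⟨k, hk⟩ := hn
    refine (h k).of_iso (kernel.mapIso _ _ (X.extendXIso embeddingDownNat hk).symm
      (Y.extendXIso embeddingDownNat hk).symm ?_)
    rw [HomologicalComplex.eval_map, HomologicalComplex.extendMap_f φ embeddingDownNat hk]
    exact (Iso.inv_hom_id_assoc (X.extendXIso embeddingDownNat hk) _).symm
  · exact .of_isZero (IsZero.of_mono (kernel.ι _)
      (X.isZero_extend_X embeddingDownNat n (not_exists.mp hn)))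

theorem isGeneratedProjective_cokernel_extendMap
    (h : ∀ k, IsGeneratedProjective ε (cokernel (φ.f k))) (n : ℤ) :
    IsGeneratedProjective ε ((cokernel (HomologicalComplex.extendMap φ embeddingDownNat)).X n) := by
  have e₁ := PreservesCokernel.iso (HomologicalComplex.eval _ _ n)
    (HomologicalComplex.extendMap φ embeddingDownNat)
  refine IsGeneratedProjective.of_iso ?_ e₁.symm
  by_cases hn : ∃ k, embeddingDownNat.f k = n
  · obtain ⟨k, hk⟩ := hn
    refine (h k).of_iso (cokernel.mapIso _ _ (X.extendXIso embeddingDownNat hk).symm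
      (Y.extendXIso embeddingDownNat hk).symm ?_)
    rw [HomologicalComplex.eval_map, HomologicalComplex.extendMap_f φ embeddingDownNat hk]
    exact (Iso.inv_hom_id_assoc (X.extendXIso embeddingDownNat hk) _).symm
  · exact .of_isZero (IsZero.of_epi (cokernel.π _)
      (Y.isZero_extend_X embeddingDownNat n (not_exists.mp hn)))

theorem isZero_extend_down_of_lt (N : ℕ) (hX : ∀ k, N < k → IsZero (X.X k)) (n : ℤ) (hn : n < -N) :
    IsZero ((X.extend embeddingDownNat).X n) := by
  obtain ⟨k, hk⟩ : ∃ k : ℕ, -(k : ℤ) = n := ⟨n.natAbs, by lia⟩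
  exact (hX k (by lia)).of_iso (X.extendXIso embeddingDownNat hk)

theorem isZero_extend_down_of_pos (n : ℤ) (hn : 0 < n) :
    IsZero ((X.extend embeddingDownNat).X n) :=
  X.isZero_extend_X embeddingDownNat n fun k (hk : -(k : ℤ) = n) => by lia

variable (P : ObjectProperty (DerivedCategory (ModuleCat.{v} R))) [P.IsTriangulated]

/-- If `P` contains the bounded complexes of modules with `IsGeneratedProjective`, it contains the
cone of a degreewise epimorphism whose kernels are such modules. -/
theorem trW_of_kernel [∀ k, Epi (φ.f k)] (N : ℕ) (hX : ∀ k, N < k → IsZero (X.X k))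
    (h : ∀ k, IsGeneratedProjective ε (kernel (φ.f k)))
    (hP : ∀ (Z : CochainComplex (ModuleCat.{v} R) ℤ) (a b : ℤ), (∀ n, n < a → IsZero (Z.X n)) →
      (∀ n, b < n → IsZero (Z.X n)) → (∀ n, IsGeneratedProjective ε (Z.X n)) →
      P (DerivedCategory.Q.obj Z)) :
    P.trW (DerivedCategory.Q.map (HomologicalComplex.extendMap φ embeddingDownNat)) := by
  set F := HomologicalComplex.extendMap φ embeddingDownNat
  have : Epi F := by
    have (n : ℤ) : Epi (F.f n) := by
      by_cases hn : ∃ k, embeddingDownNat.f k = n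
      · obtain ⟨k, hk⟩ := hn
        rw [HomologicalComplex.extendMap_f φ embeddingDownNat hk]
        infer_instance
      · exact ((Y.isZero_extend_X embeddingDownNat n (not_exists.mp hn))).epi _
    exact HomologicalComplex.epi_of_epi_f F this
  have hS : (ShortComplex.mk (kernel.ι F) F (kernel.condition F)).ShortExact :=
    { exact := ShortComplex.exact_of_f_is_kernel _ (kernelIsKernel F)
      mono_f := inferInstance
      epi_g := this }
  refine ObjectProperty.trW.mk' P (DerivedCategory.triangleOfSES_distinguished hS)
    (hP _ (-N) 0 (fun n hn => ?_) (fun n hn => ?_)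
      (isGeneratedProjective_kernel_extendMap φ h))
  · exact IsZero.of_mono ((kernel.ι F).f n) (isZero_extend_down_of_lt N hX n hn)
  · exact IsZero.of_mono ((kernel.ι F).f n) (isZero_extend_down_of_pos n hn)

/-- If `P` contains the bounded complexes of modules with `IsGeneratedProjective`, it contains the
cone of a degreewise monomorphism whose cokernels are such modules. -/
theorem trW_of_cokernel [∀ k, Mono (φ.f k)] (N : ℕ) (hY : ∀ k, N < k → IsZero (Y.X k))
    (h : ∀ k, IsGeneratedProjective ε (cokernel (φ.f k)))
    (hP : ∀ (Z : CochainComplex (ModuleCat.{v} R) ℤ) (a b : ℤ), (∀ n, n < a → IsZero (Z.X n)) →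
      (∀ n, b < n → IsZero (Z.X n)) → (∀ n, IsGeneratedProjective ε (Z.X n)) →
      P (DerivedCategory.Q.obj Z)) :
    P.trW (DerivedCategory.Q.map (HomologicalComplex.extendMap φ embeddingDownNat)) := by
  set F := HomologicalComplex.extendMap φ embeddingDownNat
  have : Mono F := by
    have (n : ℤ) : Mono (F.f n) := by
      by_cases hn : ∃ k, embeddingDownNat.f k = n
      · obtain ⟨k, hk⟩ := hn
        rw [HomologicalComplex.extendMap_f φ embeddingDownNat hk]
        infer_instance
      · exact ((X.isZero_extend_X embeddingDownNat n (not_exists.mp hn))).mono _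
    exact HomologicalComplex.mono_of_mono_f F this
  have hS : (ShortComplex.mk F (cokernel.π F) (cokernel.condition F)).ShortExact :=
    { exact := ShortComplex.exact_of_g_is_cokernel _ (cokernelIsCokernel F)
      mono_f := this
      epi_g := inferInstance }
  refine ObjectProperty.trW.mk P (DerivedCategory.triangleOfSES_distinguished hS)
    (hP _ (-N) 0 (fun n hn => ?_) (fun n hn => ?_)
      (isGeneratedProjective_cokernel_extendMap φ h))
  · exact IsZero.of_epi ((cokernel.π F).f n) (isZero_extend_down_of_lt N hY n hn)
  · exact IsZero.of_epi ((cokernel.π F).f n) (isZero_extend_down_of_pos n hn)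

end Extend

section Shift
open Limits ComplexShape
variable {C : Type*} [Category C] [Preadditive C] [HasZeroObject C]

/-- A chain complex in degrees `N, …, 0` is the shift by `N` of the cochain complex with the same
terms in degrees `0, …, N`, if the differentials agree up to the sign of the shift. -/
theorem nonempty_extend_iso_shift (X : ChainComplex C ℕ) (Y : CochainComplex C ℕ) (N : ℕ)
    (hX : ∀ k, N < k → IsZero (X.X k)) (hY : ∀ k, N < k → IsZero (Y.X k))
    (γ : ∀ i j, i + j = N → (X.X i ≅ Y.X j))
    (comm : ∀ i j (h : i + 1 + j = N), X.d (i + 1) i ≫ (γ i (j + 1) (by lia)).hom =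
      (γ (i + 1) j h).hom ≫ ((N : ℤ).negOnePow • Y.d j (j + 1))) :
    Nonempty (X.extend embeddingDownNat ≅ (Y.extend embeddingUpNat)⟦(N : ℤ)⟧) := by
  -- the compatibility with the differentials, for arbitrary isomorphisms `a`, `c`, `a'`, `c'` in
  -- place of those between the terms of a complex and of its extension
  have aux {x y x₁ y₁ x' y' x₁' y₁' : C} (a : x ≅ x₁) (g : x₁ ≅ y₁) (c : y ≅ y₁) (a' : x' ≅ x₁')
      (g' : x₁' ≅ y₁') (c' : y' ≅ y₁') (dx : x₁ ⟶ x₁') (dy : y₁ ⟶ y₁') (s : ℤˣ)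
      (hd : dx ≫ g'.hom = g.hom ≫ (s • dy)) :
      (a ≪≫ g ≪≫ c.symm).hom ≫ (s • (c.hom ≫ dy ≫ c'.inv)) =
        (a.hom ≫ dx ≫ a'.inv) ≫ (a' ≪≫ g' ≪≫ c'.symm).hom := by
    simp only [Iso.trans_hom, Iso.symm_hom, Category.assoc, Iso.inv_hom_id_assoc,
      reassoc_of% hd, Linear.comp_units_smul, Linear.units_smul_comp]
  have zX (n : ℤ) (hn : ¬ ∃ i j, i + j = N ∧ -(i : ℤ) = n) :
      IsZero ((X.extend embeddingDownNat).X n) := by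
    by_cases h : ∃ k, embeddingDownNat.f k = n
    · obtain ⟨k, hk⟩ := h
      refine (hX k ?_).of_iso (X.extendXIso embeddingDownNat hk)
      by_contra h
      exact hn ⟨k, N - k, by lia, hk⟩
    · exact X.isZero_extend_X embeddingDownNat n (not_exists.mp h)
  have zY (n : ℤ) (hn : ¬ ∃ i j, i + j = N ∧ -(i : ℤ) = n) :
      IsZero (((Y.extend embeddingUpNat)⟦(N : ℤ)⟧).X n) := by
    change IsZero ((Y.extend embeddingUpNat).X (n + N))
    by_cases h : ∃ k, embeddingUpNat.f k = n + N
    · obtain ⟨k, hk⟩ := h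
      have hk' : (k : ℤ) = n + N := hk
      refine (hY k ?_).of_iso (Y.extendXIso embeddingUpNat hk)
      by_contra h
      exact hn ⟨N - k, k, by lia, by lia⟩
    · exact Y.isZero_extend_X embeddingUpNat _ (not_exists.mp h)
  have hj {n : ℤ} {i j : ℕ} (h : i + j = N ∧ -(i : ℤ) = n) : embeddingUpNat.f j = n + N := by
    change (j : ℤ) = n + N
    lia
  let iso (n : ℤ) (i j : ℕ) (h : i + j = N ∧ -(i : ℤ) = n) :
      (X.extend embeddingDownNat).X n ≅ ((Y.extend embeddingUpNat)⟦(N : ℤ)⟧).X n :=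
    X.extendXIso embeddingDownNat h.2 ≪≫ γ i j h.1 ≪≫ (Y.extendXIso embeddingUpNat (hj h)).symm
  -- outside the degrees `-N, …, 0` both complexes vanish
  have hiso (n : ℤ) : ∃ Φ : (X.extend embeddingDownNat).X n ≅
      ((Y.extend embeddingUpNat)⟦(N : ℤ)⟧).X n,
      ∀ i j (h : i + j = N ∧ -(i : ℤ) = n), Φ = iso n i j h := by
    by_cases hn : ∃ i j, i + j = N ∧ -(i : ℤ) = n
    · obtain ⟨i, j, h⟩ := hn
      refine ⟨iso n i j h, fun i' j' h' => ?_⟩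
      obtain rfl : i = i' := by lia
      obtain rfl : j = j' := by lia
      rfl
    · exact ⟨(zX n hn).iso (zY n hn), fun i j h => absurd ⟨i, j, h⟩ hn⟩
  choose Φ hΦ using hiso
  refine ⟨HomologicalComplex.Hom.isoOfComponents Φ ?_⟩
  rintro n _ rfl
  by_cases hn : ∃ i j, i + j = N ∧ -(i : ℤ) = n
  swap
  · exact (zX n hn).eq_of_src _ _
  by_cases hn' : ∃ i j, i + j = N ∧ -(i : ℤ) = n + 1
  swap
  · exact (zY _ hn').eq_of_tgt _ _
  obtain ⟨i', j, h⟩ := hn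
  obtain ⟨i, j', h'⟩ := hn'
  obtain rfl : i' = i + 1 := by lia
  obtain rfl : j' = j + 1 := by lia
  rw [hΦ n (i + 1) j h, hΦ (n + 1) i (j + 1) h', CochainComplex.shiftFunctor_obj_d',
    X.extend_d_eq embeddingDownNat h.2 h'.2, Y.extend_d_eq embeddingUpNat (hj h) (hj h')]
  exact aux _ _ _ _ _ _ _ _ _ (comm i j h.1)

end Shift

/-! ### The enveloping algebra and derived duals -/

namespace Env
variable (K : Type u) (A : Type v) [Field K] [Ring A] [Algebra K A]

/-- The enveloping algebra is projective (indeed free) as a left `A`-module. -/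
theorem projective_left : Module.Projective A
    ((ModuleCat.restrictScalars.{v} (leftHom K A).toRingHom).obj
      (ModuleCat.of (Env K A) (Env K A))) := by
  have : Module.Free A (A ⊗[K] Aᵐᵒᵖ) :=
    .of_basis (Algebra.TensorProduct.basis A (Module.Basis.ofVectorSpace K Aᵐᵒᵖ))
  refine Module.Projective.of_equiv (M := A ⊗[K] Aᵐᵒᵖ)
    ({ AddEquiv.refl (A ⊗[K] Aᵐᵒᵖ) with map_smul' := fun x t => ?_ } : A ⊗[K] Aᵐᵒᵖ ≃ₗ[A]
      ((ModuleCat.restrictScalars.{v} (leftHom K A).toRingHom).obj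
        (ModuleCat.of (Env K A) (Env K A))))
  change x • t = (x ⊗ₜ[K] (1 : Aᵐᵒᵖ)) * t
  induction t using TensorProduct.induction_on with
  | zero => rw [smul_zero, mul_zero]
  | tmul y z => rw [TensorProduct.smul_tmul', Algebra.TensorProduct.tmul_mul_tmul, one_mul,
      smul_eq_mul]
  | add s t hs ht => rw [smul_add, mul_add, hs, ht]

/-- The enveloping algebra is projective (indeed free) as a right `A`-module. -/
theorem projective_right : Module.Projective Aᵐᵒᵖ
    ((ModuleCat.restrictScalars.{v} (rightHom K A).toRingHom).obj
      (ModuleCat.of (Env K A) (Env K A))) := by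
  have : Module.Free Aᵐᵒᵖ (Aᵐᵒᵖ ⊗[K] A) :=
    .of_basis (Algebra.TensorProduct.basis Aᵐᵒᵖ (Module.Basis.ofVectorSpace K A))
  refine Module.Projective.of_equiv (M := Aᵐᵒᵖ ⊗[K] A)
    ({ (TensorProduct.comm K Aᵐᵒᵖ A).toAddEquiv with map_smul' := fun x t => ?_ } :
      Aᵐᵒᵖ ⊗[K] A ≃ₗ[Aᵐᵒᵖ] ((ModuleCat.restrictScalars.{v} (rightHom K A).toRingHom).obj
        (ModuleCat.of (Env K A) (Env K A))))
  change TensorProduct.comm K Aᵐᵒᵖ A (x • t) = ((1 : A) ⊗ₜ[K] x) * TensorProduct.comm K Aᵐᵒᵖ A t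
  induction t using TensorProduct.induction_on with
  | zero => rw [smul_zero, map_zero, mul_zero]
  | tmul y z => rw [TensorProduct.smul_tmul', TensorProduct.comm_tmul, TensorProduct.comm_tmul,
      Algebra.TensorProduct.tmul_mul_tmul, one_mul, smul_eq_mul]
  | add s t hs ht => rw [smul_add, map_add, map_add, mul_add, hs, ht]

variable {A}

/-- `(x ⊗ y) (e ⊗ e) = (x ⊗ 1) (e ⊗ 1) (1 ⊗ e y)`. -/
theorem mul_tmul_mem_left (e : A) (r : Env K A) : r * tmul K e e ∈ AddSubmonoid.closure
    {x | ∃ b s, x = (leftHom K A).toRingHom b * (leftHom K A).toRingHom e * s} := by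
  induction r using induction_on with
  | zero => rw [zero_mul]; exact zero_mem _
  | tmul x y =>
    refine AddSubmonoid.subset_closure ⟨x, tmul K 1 (e * y), ?_⟩
    change _ = tmul K x 1 * tmul K e 1 * _
    simp only [tmul_mul_tmul, mul_one]
  | add r s hr hs => rw [add_mul]; exact add_mem hr hs

/-- `(x ⊗ y) (e ⊗ e) = (1 ⊗ y) (1 ⊗ e) (x e ⊗ 1)`, as the second factor is `Aᵐᵒᵖ`. -/
theorem mul_tmul_mem_right (e : A) (r : Env K A) : r * tmul K e e ∈ AddSubmonoid.closure
    {x | ∃ b s, x = (rightHom K A).toRingHom b * (rightHom K A).toRingHom (op e) * s} := by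
  induction r using induction_on with
  | zero => rw [zero_mul]; exact zero_mem _
  | tmul x y =>
    refine AddSubmonoid.subset_closure ⟨op y, tmul K (x * e) 1, ?_⟩
    change _ = tmul K 1 y * tmul K 1 e * _
    simp only [tmul_mul_tmul, one_mul]
  | add r s hr hs => rw [add_mul]; exact add_mem hr hs

end Env

section DualComplex
variable {C D : Type*} [Category C] [Preadditive C] [Category D] [Preadditive D]
  (F : Cᵒᵖ ⥤ D) [F.Additive] {X Y : ChainComplex C ℕ}

/-- The cochain complex obtained by applying a contravariant functor to a chain complex. -/
def contravariantComplex (X : ChainComplex C ℕ) : CochainComplex D ℕ :=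
  (F.mapHomologicalComplex (ComplexShape.up ℕ)).obj X.op

/-- The map of cochain complexes obtained by applying a contravariant functor. -/
def contravariantMap (f : X ⟶ Y) : contravariantComplex F Y ⟶ contravariantComplex F X :=
  (F.mapHomologicalComplex (ComplexShape.up ℕ)).map
    ((HomologicalComplex.opFunctor C (ComplexShape.down ℕ)).map f.op)

/-- The image of a morphism between the terms of two chain complexes. -/
def contravariantHom {i j : ℕ} (k : X.X i ⟶ Y.X j) :
    (contravariantComplex F Y).X j ⟶ (contravariantComplex F X).X i := F.map k.op

/-- A contravariant additive functor preserves homotopies. -/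
def contravariantHomotopy {f g : X ⟶ Y} (h : Homotopy f g) :
    Homotopy (contravariantMap F f) (contravariantMap F g) where
  hom i j := contravariantHom F (h.hom j i)
  zero i j hij :=
    (congrArg (contravariantHom F) (h.zero j i fun hji => hij hji)).trans (F.map_zero _ _)
  comm i := by
    have hd : contravariantHom F (dNext i h.hom) =
        prevD i (fun i j => contravariantHom F (h.hom j i)) := by
      cases i with
      | zero =>
        rw [dNext_eq_zero _ _ (by simp), prevD_eq_zero _ _ (by simp)]
        exact F.map_zero _ _
      | succ i =>
        rw [dNext_eq h.hom (show (ComplexShape.down ℕ).Rel (i + 1) i from rfl),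
          prevD_eq _ (show (ComplexShape.up ℕ).Rel i (i + 1) from rfl)]
        exact F.map_comp _ _
    have hp : contravariantHom F (prevD i h.hom) =
        dNext i (fun i j => contravariantHom F (h.hom j i)) := by
      rw [prevD_eq h.hom (show (ComplexShape.down ℕ).Rel (i + 1) i from rfl),
        dNext_eq _ (show (ComplexShape.up ℕ).Rel i (i + 1) from rfl)]
      exact F.map_comp _ _
    rw [← hd, ← hp]
    refine (congrArg (contravariantHom F) (h.comm i)).trans ?_
    refine F.map_add.trans (congrArg (· + contravariantHom F (g.f i)) ?_)
    exact F.map_add.trans (add_comm _ _)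

theorem contravariantMap_id :
    contravariantMap F (𝟙 X) = 𝟙 (contravariantComplex F X) :=
  HomologicalComplex.hom_ext _ _ fun _ => F.map_id _

theorem contravariantMap_comp {Z : ChainComplex C ℕ} (f : X ⟶ Y) (g : Y ⟶ Z) :
    contravariantMap F (f ≫ g) = contravariantMap F g ≫ contravariantMap F f :=
  HomologicalComplex.hom_ext _ _ fun i => F.map_comp (g.f i).op (f.f i).op

/-- The image of a homotopy equivalence under a contravariant functor. -/
def contravariantHomotopyEquiv (φ : HomotopyEquiv X Y) :
    HomotopyEquiv (contravariantComplex F Y) (contravariantComplex F X) where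
  hom := contravariantMap F φ.hom
  inv := contravariantMap F φ.inv
  homotopyHomInvId := (Homotopy.ofEq (contravariantMap_comp F _ _).symm).trans
    ((contravariantHomotopy F φ.homotopyInvHomId).trans (.ofEq (contravariantMap_id F)))
  homotopyInvHomId := (Homotopy.ofEq (contravariantMap_comp F _ _).symm).trans
    ((contravariantHomotopy F φ.homotopyHomInvId).trans (.ofEq (contravariantMap_id F)))

end DualComplex

/-- The derived dual does not depend on the projective resolution by which it is computed. -/
theorem Env.nonempty_dualComplex_iso (K : Type u) (A : Type v) [Field K] [Ring A] [Algebra K A]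
    {M : ModuleCat.{v} (Env K A)} (P P' : ProjectiveResolution M) :
    Nonempty (DerivedCategory.Q.obj (Env.dualComplex K A P) ≅
      DerivedCategory.Q.obj (Env.dualComplex K A P')) := by
  have φ := contravariantHomotopyEquiv (Env.dualFunctor K A) (P'.homotopyEquiv P)
  have h := (HomologicalComplex.homotopyEquivalences_extendMap_iff φ.hom
    ComplexShape.embeddingUpNat).mpr ⟨φ, rfl⟩
  have : QuasiIso (HomologicalComplex.extendMap φ.hom ComplexShape.embeddingUpNat) := by
    obtain ⟨ψ, hψ⟩ := h
    rw [← hψ]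
    infer_instance
  let Φ : Env.dualComplex K A P ⟶ Env.dualComplex K A P' :=
    HomologicalComplex.extendMap φ.hom ComplexShape.embeddingUpNat
  have hΦ : QuasiIso Φ := this
  have : IsIso (DerivedCategory.Q.map Φ) :=
    (DerivedCategory.isIso_Q_map_iff_quasiIso _ Φ).mpr hΦ
  exact ⟨asIso (DerivedCategory.Q.map Φ)⟩

section Resolution
variable {R : Type v} [Ring R] {M : ModuleCat.{v} R} (P : ProjectiveResolution M)

theorem hasProjectiveDimensionLT_of_resolution (N : ℕ)
    (h : ∀ k, N ≤ k → Limits.IsZero (P.complex.X k)) : HasProjectiveDimensionLT M N := by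
  let := HasExt.standard (ModuleCat.{v} R)
  rw [hasProjectiveDimensionLT_iff]
  intro i hi Y e
  obtain ⟨f, hf, rfl⟩ := P.extMk_surjective e (i + 1) rfl
  obtain rfl := (h i hi).eq_of_src f 0
  exact P.extMk_zero (i + 1) rfl

/-- The resolution, as a complex in the derived category, is the module that it resolves. -/
def resolutionIso : DerivedCategory.Q.obj P.cochainComplex ≅
    (DerivedCategory.singleFunctor (ModuleCat.{v} R) 0).obj M :=
  asIso (DerivedCategory.Q.map P.π') ≪≫
    ((DerivedCategory.singleFunctorIsoCompQ (ModuleCat.{v} R) 0).app M).symm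

theorem isPerfectObj_of_resolution (N : ℕ) (h : ∀ k, N < k → Limits.IsZero (P.complex.X k))
    (hfin : ∀ k, Module.Finite R (P.complex.X k)) :
    IsPerfectObj ((DerivedCategory.singleFunctor (ModuleCat.{v} R) 0).obj M) := by
  refine ⟨P.cochainComplex, ⟨-N, 0, fun n hn => ?_⟩, fun n => ⟨?_, ?_⟩, ⟨resolutionIso P⟩⟩
  · rcases hn with hn | hn
    · exact isZero_extend_down_of_lt N h n hn
    · exact isZero_extend_down_of_pos n hn
  · exact (IsProjective.iff_projective _).mpr
      (inferInstanceAs (Projective (P.cochainComplex.X n)))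
  · by_cases hn : ∃ k, ComplexShape.embeddingDownNat.f k = n
    · obtain ⟨k, hk⟩ := hn
      have := hfin k
      exact Module.Finite.equiv
        (P.complex.extendXIso ComplexShape.embeddingDownNat hk).symm.toLinearEquiv
    · have : Subsingleton (P.cochainComplex.X n) :=
        ModuleCat.subsingleton_of_isZero (P.complex.isZero_extend_X
          ComplexShape.embeddingDownNat n (not_exists.mp hn))
      infer_instance

end Resolution

namespace IceQuiver
open TensorBimod
universe u₁ u₂ u₃
variable {K : Type u₁} {V : Type u₂} {E : Type u₃} [Field K] [Fintype V] [DecidableEq V]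
  [Fintype E] [DecidableEq E] {Q : IceQuiver V E} (W : Q.Potential K)

-- The three instances below are found by a long search through the quotient of a subalgebra of
-- matrices; they are recorded here because nearly every later elaboration step needs them.
local instance : Ring (Q.FrozenJacobian W) := inferInstance
local instance : Algebra K (Q.FrozenJacobian W) := inferInstance
local instance : Ring (Env K (Q.FrozenJacobian W)) := inferInstance

/-! ### Frozen summands and the resolution -/

theorem frozenIdempotent_mul_vertexClass (v : V) (hv : v ∈ Q.frozenV) :
    frozenIdempotent W * vertexClass W v = vertexClass W v := by
  rw [frozenIdempotent, Finset.sum_mul, Finset.sum_eq_single v, (isRep W).idem]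
  · exact fun w _ hw => (isRep W).mul_ne w v hw
  · exact fun h => absurd hv h

theorem vertexClass_mul_frozenIdempotent (v : V) (hv : v ∈ Q.frozenV) :
    vertexClass W v * frozenIdempotent W = vertexClass W v := by
  rw [frozenIdempotent, Finset.mul_sum, Finset.sum_eq_single v, (isRep W).idem]
  · exact fun w _ hw => (isRep W).mul_ne v w hw.symm
  · exact fun h => absurd hv h

theorem frozenIdempotent_idem : IsIdempotentElem (frozenIdempotent W) := by
  rw [IsIdempotentElem]
  conv_lhs => rw [frozenIdempotent, Finset.sum_mul]
  exact Finset.sum_congr rfl fun v hv => vertexClass_mul_frozenIdempotent W v hv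

/-- Summands that sit at pairs of frozen vertices are generated over the enveloping algebra by
their image under `e ⊗ e`. -/
theorem span_frozenIdempotent_smul {ι : Type*} [Fintype ι] [DecidableEq ι] (l r : ι → V)
    (hl : ∀ i, l i ∈ Q.frozenV) (hr : ∀ i, r i ∈ Q.frozenV) :
    Submodule.span (Env K (Q.FrozenJacobian W))
      (Set.range fun m : TensorBimod K (vertexClass W) l r =>
        Env.tmul K (frozenIdempotent W) (frozenIdempotent W) • m) = ⊤ := by
  rw [eq_top_iff]
  rintro s -
  obtain ⟨c, rfl⟩ := eq_sum_smul_gen K (vertexClass W) l r s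
  refine Submodule.sum_mem _ fun i _ => Submodule.smul_mem _ _ (Submodule.subset_span
    ⟨gen K (vertexClass W) l r i, ?_⟩)
  change Env.tmul K _ _ • gen K (vertexClass W) l r i = _
  rw [← gen_smul_self K (vertexClass W) l r (isRep W).idem i, smul_smul, Env.tmul_mul_tmul,
    frozenIdempotent_mul_vertexClass W _ (hl i), vertexClass_mul_frozenIdempotent W _ (hr i)]

/-- The projective resolution of the bimodule `A` given by `Res(A)`. -/
def resolution (h : QuasiIso (augmentation W)) :
    ProjectiveResolution (Env.diagonal K (Q.FrozenJacobian W)) where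
  complex := res W
  projective
    | 0 => (IsProjective.iff_projective _).mp (TensorBimod.projective K _ _ _ (isRep W).idem)
    | 1 => (IsProjective.iff_projective _).mp (TensorBimod.projective K _ _ _ (isRep W).idem)
    | 2 => (IsProjective.iff_projective _).mp (TensorBimod.projective K _ _ _ (isRep W).idem)
    | 3 => (IsProjective.iff_projective _).mp (TensorBimod.projective K _ _ _ (isRep W).idem)
    | _ + 4 => (ModuleCat.isZero_of_subsingleton
        (ModuleCat.of (Env K (Q.FrozenJacobian W)) PUnit)).projective
  π := augmentation W

theorem finite_res : ∀ n, Module.Finite (Env K (Q.FrozenJacobian W)) ((res W).X n)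
  | 0 => inferInstanceAs (Module.Finite _ (P₀ K (vertexClass W)))
  | 1 => inferInstanceAs (Module.Finite _ (Q.P₁ K (vertexClass W)))
  | 2 => inferInstanceAs (Module.Finite _ (Q.P₂ K (vertexClass W)))
  | 3 => inferInstanceAs (Module.Finite _ (Q.P₃ K (vertexClass W)))
  | _ + 4 => inferInstanceAs (Module.Finite (Env K (Q.FrozenJacobian W)) PUnit.{max u₁ u₂ u₃ + 1})

theorem isZero_res : ∀ n, 3 < n → Limits.IsZero ((res W).X n)
  | n + 4, _ => ModuleCat.isZero_of_subsingleton
        (ModuleCat.of (Env K (Q.FrozenJacobian W)) PUnit)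
  | 0, h | 1, h | 2, h | 3, h => absurd h (by lia)

/-! ### The comparison of Res(A) with its shifted dual -/

/-- The terms of the dual of `Res(A)`, in the reverse order. -/
def dualResX : ℕ → ModuleCat.{max u₁ u₂ u₃} (Env K (Q.FrozenJacobian W))
  | 0 => ModuleCat.of _ (Env.Dual K (Q.FrozenJacobian W) (Q.P₃ K (vertexClass W)))
  | 1 => ModuleCat.of _ (Env.Dual K (Q.FrozenJacobian W) (Q.P₂ K (vertexClass W)))
  | 2 => ModuleCat.of _ (Env.Dual K (Q.FrozenJacobian W) (Q.P₁ K (vertexClass W)))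
  | 3 => ModuleCat.of _ (Env.Dual K (Q.FrozenJacobian W) (P₀ K (vertexClass W)))
  | _ + 4 => ModuleCat.of _ PUnit

/-- The differentials of the shifted dual of `Res(A)`; the sign is that of the shift by three. -/
def dualResD : ∀ n, dualResX W (n + 1) ⟶ dualResX W n
  | 0 => ModuleCat.ofHom (-Env.dualMap K (Q.mu₃ K (vertexClass W) (arrowClass W)))
  | 1 => ModuleCat.ofHom (-Env.dualMap K (Q.mu₂ K (vertexClass W) (arrowClass W) W))
  | 2 => ModuleCat.ofHom (-Env.dualMap K (Q.mu₁ K (vertexClass W) (arrowClass W)))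
  | _ + 3 => 0

theorem dualResD_comp : ∀ n, dualResD W (n + 1) ≫ dualResD W n = 0
  | 0 => ModuleCat.hom_ext (Env.dualMap_comp_eq_zero K _ _ (mu₂_comp_mu₃ (isRep W) W (relations W)))
  | 1 => ModuleCat.hom_ext (Env.dualMap_comp_eq_zero K _ _ (mu₁_comp_mu₂ (isRep W) W (relations W)))
  | _ + 2 => Limits.zero_comp

/-- The complex `Res(A)* [3]`, as a chain complex in degrees `3, 2, 1, 0`. -/
def dualRes : ChainComplex (ModuleCat.{max u₁ u₂ u₃} (Env K (Q.FrozenJacobian W))) ℕ :=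
  ChainComplex.of (dualResX W) (dualResD W) (dualResD_comp W)

/-- The terms of the complex `P₃ ⟶ P₂ ⟶ P₂* ⟶ P₃*`. -/
def imageX : ℕ → ModuleCat.{max u₁ u₂ u₃} (Env K (Q.FrozenJacobian W))
  | 0 => ModuleCat.of _ (Env.Dual K (Q.FrozenJacobian W) (Q.P₃ K (vertexClass W)))
  | 1 => ModuleCat.of _ (Env.Dual K (Q.FrozenJacobian W) (Q.P₂ K (vertexClass W)))
  | 2 => ModuleCat.of _ (Q.P₂ K (vertexClass W))
  | 3 => ModuleCat.of _ (Q.P₃ K (vertexClass W))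
  | _ + 4 => ModuleCat.of _ PUnit

/-- The differentials of the complex `P₃ ⟶ P₂ ⟶ P₂* ⟶ P₃*`; the middle one is the composite
`P₂ ⟶ P₁ ⟶ P₂*`. -/
def imageD : ∀ n, imageX W (n + 1) ⟶ imageX W n
  | 0 => ModuleCat.ofHom (-Env.dualMap K (Q.mu₃ K (vertexClass W) (arrowClass W)))
  | 1 => ModuleCat.ofHom (phi₁ Q K (vertexClass W) ∘ₗ Q.mu₂ K (vertexClass W) (arrowClass W) W)
  | 2 => ModuleCat.ofHom (Q.mu₃ K (vertexClass W) (arrowClass W))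
  | _ + 3 => 0

theorem imageD_comp : ∀ n, imageD W (n + 1) ≫ imageD W n = 0
  | 0 => ModuleCat.hom_ext (by
      have h := (phi₀_comp_mu₁ (K := K) (isRep W)).trans (LinearMap.neg_comp _ _).symm
      have h' := mu₁_comp_mu₂ (isRep W) W (relations W)
      exact (LinearMap.comp_assoc _ _ _).symm.trans ((congrArg (· ∘ₗ _) h.symm).trans
        ((LinearMap.comp_assoc _ _ _).trans ((congrArg (_ ∘ₗ ·) h').trans
          (LinearMap.comp_zero _)))))
  | 1 => ModuleCat.hom_ext (by
      change (phi₁ Q K (vertexClass W) ∘ₗ Q.mu₂ K (vertexClass W) (arrowClass W) W) ∘ₗ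
        Q.mu₃ K (vertexClass W) (arrowClass W) = 0
      rw [LinearMap.comp_assoc, mu₂_comp_mu₃ (isRep W) W (relations W), LinearMap.comp_zero])
  | _ + 2 => Limits.zero_comp

/-- The complex `P₃ ⟶ P₂ ⟶ P₂* ⟶ P₃*` in degrees `3, 2, 1, 0`. -/
def imageRes : ChainComplex (ModuleCat.{max u₁ u₂ u₃} (Env K (Q.FrozenJacobian W))) ℕ :=
  ChainComplex.of (imageX W) (imageD W) (imageD_comp W)

/-- The components of the projection from `Res(A)`. -/
def toImageF : ∀ n, resX W n ⟶ imageX W n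
  | 0 => ModuleCat.ofHom (phi₀ Q K (vertexClass W))
  | 1 => ModuleCat.ofHom (phi₁ Q K (vertexClass W))
  | 2 => 𝟙 (ModuleCat.of _ (Q.P₂ K (vertexClass W)))
  | 3 => 𝟙 (ModuleCat.of _ (Q.P₃ K (vertexClass W)))
  | _ + 4 => 𝟙 (ModuleCat.of _ PUnit)

theorem toImageF_comm : ∀ n, toImageF W (n + 1) ≫ imageD W n = resD W n ≫ toImageF W n
  | 0 => ModuleCat.hom_ext ((phi₀_comp_mu₁ (isRep W)).trans (LinearMap.neg_comp _ _).symm).symm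
  | 1 => rfl
  | 2 => rfl
  | _ + 3 => Limits.comp_zero.trans Limits.zero_comp.symm

/-- The projection from `Res(A)`. -/
def toImage : res W ⟶ imageRes W := ChainComplex.ofHom (toImageF W) fun n =>
  (congrArg (toImageF W (n + 1) ≫ ·) (ChainComplex.of_d (imageX W) (imageD W) n)).trans
    ((toImageF_comm W n).trans (congrArg (· ≫ toImageF W n)
      (ChainComplex.of_d (resX W) (resD W) n).symm))

/-- The components of the inclusion into `Res(A)* [3]`. -/
def ofImageF : ∀ n, imageX W n ⟶ dualResX W n
  | 0 => 𝟙 (ModuleCat.of _ (Env.Dual K (Q.FrozenJacobian W) (Q.P₃ K (vertexClass W))))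
  | 1 => 𝟙 (ModuleCat.of _ (Env.Dual K (Q.FrozenJacobian W) (Q.P₂ K (vertexClass W))))
  | 2 => ModuleCat.ofHom (phi₂ Q K (vertexClass W))
  | 3 => ModuleCat.ofHom (phi₃ Q K (vertexClass W))
  | _ + 4 => 𝟙 (ModuleCat.of _ PUnit)

theorem ofImageF_comm : ∀ n, ofImageF W (n + 1) ≫ dualResD W n = imageD W n ≫ ofImageF W n
  | 0 => rfl
  | 1 => ModuleCat.hom_ext
      ((phi₁_comp_mu₂ (isRep W) W).trans (LinearMap.neg_comp _ _).symm).symm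
  | 2 => ModuleCat.hom_ext ((phi₂_comp_mu₃ (isRep W)).trans (LinearMap.neg_comp _ _).symm).symm
  | _ + 3 => Limits.comp_zero.trans Limits.zero_comp.symm

/-- The inclusion into `Res(A)* [3]`. -/
def ofImage : imageRes W ⟶ dualRes W := ChainComplex.ofHom (ofImageF W) fun n =>
  (congrArg (ofImageF W (n + 1) ≫ ·) (ChainComplex.of_d (dualResX W) (dualResD W) n)).trans
    ((ofImageF_comm W n).trans (congrArg (· ≫ ofImageF W n)
      (ChainComplex.of_d (imageX W) (imageD W) n).symm))

/-! ### The frozen kernels and cokernels -/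

instance epi_toImage_f : ∀ k, Epi ((toImage W).f k)
  | 0 => (ModuleCat.epi_iff_surjective (ModuleCat.ofHom (phi₀ Q K (vertexClass W)))).mpr
      (neg_surjective.comp ((toDual_surjective K _ _ _ (isRep W).idem).comp
        (restrict_surjective _ _ _)))
  | 1 => (ModuleCat.epi_iff_surjective (ModuleCat.ofHom (phi₁ Q K (vertexClass W)))).mpr
      (neg_surjective.comp ((toDual_surjective K _ _ _ (isRep W).idem).comp
        (restrict_surjective _ _ _)))
  | 2 => inferInstanceAs (Epi (𝟙 (ModuleCat.of _ (Q.P₂ K (vertexClass W)))))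
  | 3 => inferInstanceAs (Epi (𝟙 (ModuleCat.of _ (Q.P₃ K (vertexClass W)))))
  | _ + 4 => inferInstanceAs (Epi (𝟙 (ModuleCat.of (Env K (Q.FrozenJacobian W))
      PUnit.{max u₁ u₂ u₃ + 1})))

instance mono_ofImage_f : ∀ k, Mono ((ofImage W).f k)
  | 0 => inferInstanceAs (Mono
      (𝟙 (ModuleCat.of _ (Env.Dual K (Q.FrozenJacobian W) (Q.P₃ K (vertexClass W))))))
  | 1 => inferInstanceAs (Mono
      (𝟙 (ModuleCat.of _ (Env.Dual K (Q.FrozenJacobian W) (Q.P₂ K (vertexClass W))))))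
  | 2 => (ModuleCat.mono_iff_injective (ModuleCat.ofHom (phi₂ Q K (vertexClass W)))).mpr
      ((toDual_injective K _ _ _ (isRep W).idem).comp (extend_injective _ _ _))
  | 3 => (ModuleCat.mono_iff_injective (ModuleCat.ofHom (phi₃ Q K (vertexClass W)))).mpr
      ((toDual_injective K _ _ _ (isRep W).idem).comp (extend_injective _ _ _))
  | _ + 4 => inferInstanceAs (Mono (𝟙 (ModuleCat.of (Env K (Q.FrozenJacobian W))
      PUnit.{max u₁ u₂ u₃ + 1})))

/-- The frozen summands of `A ⊗_S KQ₀ ⊗_S A`. -/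
theorem isGeneratedProjective_frozenVertex :
    IsGeneratedProjective (Env.tmul K (frozenIdempotent W) (frozenIdempotent W))
      (ModuleCat.of.{max u₁ u₂ u₃} (Env K (Q.FrozenJacobian W))
        (TensorBimod K (vertexClass W) (fun v : {v // ¬ v ∉ Q.frozenV} => v.1)
          (fun v => v.1))) where
  projective := TensorBimod.projective K _ _ _ (isRep W).idem
  span := span_frozenIdempotent_smul W _ _ (fun v => not_not.mp v.2) fun v => not_not.mp v.2

/-- The frozen summands of `A ⊗_S KQ₁ ⊗_S A` and of its dual. -/
theorem isGeneratedProjective_frozenArrow (l r : E → V) (hl : ∀ α ∈ Q.frozenE, l α ∈ Q.frozenV)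
    (hr : ∀ α ∈ Q.frozenE, r α ∈ Q.frozenV) :
    IsGeneratedProjective (Env.tmul K (frozenIdempotent W) (frozenIdempotent W))
      (ModuleCat.of.{max u₁ u₂ u₃} (Env K (Q.FrozenJacobian W))
        (TensorBimod K (vertexClass W) (fun α : {α // ¬ α ∉ Q.frozenE} => l α.1)
          (fun α => r α.1))) where
  projective := TensorBimod.projective K _ _ _ (isRep W).idem
  span := span_frozenIdempotent_smul W _ _ (fun α => hl _ (not_not.mp α.2))
    fun α => hr _ (not_not.mp α.2)

theorem isGeneratedProjective_kernel_toImage : ∀ k,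
    IsGeneratedProjective (Env.tmul K (frozenIdempotent W) (frozenIdempotent W))
      (Limits.kernel ((toImage W).f k))
  | 0 => IsGeneratedProjective.kernel_of_exact _ (phi₀ Q K (vertexClass W))
      (extend_injective _ _ _) (exact_extend_neg_toDual_restrict _ _ (fun v => ¬ v ∉ Q.frozenV) _
        (isRep W).idem fun _ => Iff.rfl) (isGeneratedProjective_frozenVertex W)
  | 1 => IsGeneratedProjective.kernel_of_exact _ (phi₁ Q K (vertexClass W))
      (extend_injective _ _ _) (exact_extend_neg_toDual_restrict _ _ (fun α => ¬ α ∉ Q.frozenE) _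
        (isRep W).idem fun _ => Iff.rfl)
      (isGeneratedProjective_frozenArrow W _ _ Q.tgt_mem Q.src_mem)
  | 2 => .of_isZero (Limits.isZero_kernel_of_mono (𝟙 (ModuleCat.of _ (Q.P₂ K (vertexClass W)))))
  | 3 => .of_isZero (Limits.isZero_kernel_of_mono (𝟙 (ModuleCat.of _ (Q.P₃ K (vertexClass W)))))
  | _ + 4 => .of_isZero (Limits.isZero_kernel_of_mono (𝟙 (ModuleCat.of (Env K (Q.FrozenJacobian W))
      PUnit.{max u₁ u₂ u₃ + 1})))

theorem isGeneratedProjective_cokernel_ofImage : ∀ k,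
    IsGeneratedProjective (Env.tmul K (frozenIdempotent W) (frozenIdempotent W))
      (Limits.cokernel ((ofImage W).f k))
  | 0 => .of_isZero (Limits.isZero_cokernel_of_epi
      (𝟙 (ModuleCat.of _ (Env.Dual K (Q.FrozenJacobian W) (Q.P₃ K (vertexClass W))))))
  | 1 => .of_isZero (Limits.isZero_cokernel_of_epi
      (𝟙 (ModuleCat.of _ (Env.Dual K (Q.FrozenJacobian W) (Q.P₂ K (vertexClass W))))))
  | 2 => IsGeneratedProjective.cokernel_of_exact (phi₂ Q K (vertexClass W)) _
      (restrict_comp_dualEquiv_symm_surjective _ _ _ (isRep W).idem)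
      (exact_toDual_extend_restrict _ _ _ (fun α => ¬ α ∉ Q.frozenE) (isRep W).idem
        fun _ => not_not.symm) (isGeneratedProjective_frozenArrow W _ _ Q.src_mem Q.tgt_mem)
  | 3 => IsGeneratedProjective.cokernel_of_exact (phi₃ Q K (vertexClass W)) _
      (restrict_comp_dualEquiv_symm_surjective _ _ _ (isRep W).idem)
      (exact_toDual_extend_restrict _ _ _ (fun v => ¬ v ∉ Q.frozenV) (isRep W).idem
        fun _ => not_not.symm) (isGeneratedProjective_frozenVertex W)
  | _ + 4 => .of_isZero (Limits.isZero_cokernel_of_epi (𝟙 (ModuleCat.of (Env K (Q.FrozenJacobian W))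
      PUnit.{max u₁ u₂ u₃ + 1})))

/-! ### The cone of the comparison map -/

theorem isZero_dualRes : ∀ n, 3 < n → Limits.IsZero ((dualRes W).X n)
  | n + 4, _ => ModuleCat.isZero_of_subsingleton
        (ModuleCat.of (Env K (Q.FrozenJacobian W)) PUnit)
  | 0, h | 1, h | 2, h | 3, h => absurd h (by lia)

/-- The terms of `dualRes` are the duals of those of `res`, in the reverse order. -/
def dualResXIso : ∀ i j, i + j = 3 →
    ((dualRes W).X i ≅ (contravariantComplex (Env.dualFunctor K (Q.FrozenJacobian W)) (res W)).X j)
  | 0, 3, _ => Iso.refl (ModuleCat.of _ (Env.Dual K (Q.FrozenJacobian W) (Q.P₃ K (vertexClass W))))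
  | 1, 2, _ => Iso.refl (ModuleCat.of _ (Env.Dual K (Q.FrozenJacobian W) (Q.P₂ K (vertexClass W))))
  | 2, 1, _ => Iso.refl (ModuleCat.of _ (Env.Dual K (Q.FrozenJacobian W) (Q.P₁ K (vertexClass W))))
  | 3, 0, _ => Iso.refl (ModuleCat.of _ (Env.Dual K (Q.FrozenJacobian W) (P₀ K (vertexClass W))))
  | 1, _ + 3, h | 2, _ + 2, h | 3, _ + 1, h | _ + 4, _, h => absurd h (by lia)

/-- The differentials agree up to the sign of the shift by three. -/
theorem dualResXIso_comm (i j) (h : i + 1 + j = 3) :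
    (dualRes W).d (i + 1) i ≫ (dualResXIso W i (j + 1) (by lia)).hom =
      (dualResXIso W (i + 1) j h).hom ≫ (((3 : ℕ) : ℤ).negOnePow •
        (contravariantComplex (Env.dualFunctor K (Q.FrozenJacobian W)) (res W)).d j (j + 1)) := by
  let F := Env.dualFunctor K (Q.FrozenJacobian W)
  have h1 : (contravariantComplex F (res W)).d j (j + 1) = F.map (resD W j).op :=
    congrArg (fun f => F.map (Quiver.Hom.op f)) (ChainComplex.of_d (resX W) (resD W) j)
  have h2 : ((3 : ℕ) : ℤ).negOnePow • F.map (resD W j).op = -F.map (resD W j).op := by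
    rw [show ((3 : ℕ) : ℤ).negOnePow = -1 by decide, Units.neg_smul, one_smul]
  have h3 : (dualRes W).d (i + 1) i = dualResD W i := ChainComplex.of_d (dualResX W) (dualResD W) i
  rw [h1, h3]
  refine Eq.trans ?_ (congrArg ((dualResXIso W (i + 1) j h).hom ≫ ·) h2.symm)
  obtain ⟨rfl, rfl⟩ | ⟨rfl, rfl⟩ | ⟨rfl, rfl⟩ :
    i = 0 ∧ j = 2 ∨ i = 1 ∧ j = 1 ∨ i = 2 ∧ j = 0 := by lia
  all_goals rfl

/-- The complex `Res(A)* [3]` computes `RHom_{Aᵉ}(A, Aᵉ)[3]` if `Res(A)` resolves `A`. -/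
theorem nonempty_Q_dualRes_iso (h : QuasiIso (augmentation W)) :
    Nonempty (DerivedCategory.Q.obj ((dualRes W).extend ComplexShape.embeddingDownNat) ≅
      (Env.omega K (Q.FrozenJacobian W))⟦((3 : ℕ) : ℤ)⟧) := by
  obtain ⟨a⟩ := nonempty_extend_iso_shift (dualRes W)
    (contravariantComplex (Env.dualFunctor K (Q.FrozenJacobian W)) (res W)) 3 (isZero_dualRes W)
    (fun k hk => (Env.dualFunctor K (Q.FrozenJacobian W)).map_isZero (isZero_res W k hk).op)
    (dualResXIso W) (dualResXIso_comm W)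
  obtain ⟨b⟩ := Env.nonempty_dualComplex_iso K (Q.FrozenJacobian W) (resolution W h)
    (projectiveResolution (Env.diagonal K (Q.FrozenJacobian W)))
  exact ⟨DerivedCategory.Q.mapIso a ≪≫ (DerivedCategory.Q.commShiftIso ((3 : ℕ) : ℤ)).app _ ≪≫
    (shiftFunctor _ ((3 : ℕ) : ℤ)).mapIso b⟩

/-- The comparison map `Res(A) ⟶ Res(A)* [3]` in the derived category. -/
def comparison : DerivedCategory.Q.obj ((res W).extend ComplexShape.embeddingDownNat) ⟶
    DerivedCategory.Q.obj ((dualRes W).extend ComplexShape.embeddingDownNat) :=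
  DerivedCategory.Q.map (HomologicalComplex.extendMap (toImage W) ComplexShape.embeddingDownNat) ≫
    DerivedCategory.Q.map (HomologicalComplex.extendMap (ofImage W) ComplexShape.embeddingDownNat)

/-- The cone of the comparison map is left orthogonal, after restriction along `f`, to the complexes
whose cohomology is annihilated by `e₀`. -/
theorem trW_comparison {B : Type max u₁ u₂ u₃} [Ring B] (f : B →+* Env K (Q.FrozenJacobian W))
    (hf : Module.Projective B ((ModuleCat.restrictScalars.{max u₁ u₂ u₃} f).obj
      (ModuleCat.of _ (Env K (Q.FrozenJacobian W))))) {e₀ : B}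
    (h : ∀ r : Env K (Q.FrozenJacobian W),
      r * Env.tmul K (frozenIdempotent W) (frozenIdempotent W) ∈
        AddSubmonoid.closure {x | ∃ b s, x = f b * f e₀ * s}) :
    ((cohomologyKilledBy e₀).leftOrthogonal.inverseImage
      (ModuleCat.restrictScalars.{max u₁ u₂ u₃} f).mapDerivedCategory).trW (comparison W) :=
  MorphismProperty.comp_mem _ _ _
    (trW_of_kernel (toImage W) _ 3 (isZero_res W) (isGeneratedProjective_kernel_toImage W)
      (leftOrthogonal_map_of_bounded f hf h))
    (trW_of_cokernel (ofImage W) _ 3 (isZero_dualRes W) (isGeneratedProjective_cokernel_ofImage W)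
      (leftOrthogonal_map_of_bounded f hf h))

end IceQuiver

end

theorem mainTheorem3 {K V E : Type*} [Field K] [Fintype V] [DecidableEq V] [Fintype E]
    [DecidableEq E] (Q : IceQuiver V E) (W : Q.Potential K)
    (h : QuasiIso (IceQuiver.augmentation W)) :
    IsBimoduleInternallyCY K (IceQuiver.frozenIdempotent W) 3 := by
  refine ⟨IceQuiver.frozenIdempotent_idem W,
    hasProjectiveDimensionLT_of_resolution (IceQuiver.resolution W h) 4 (IceQuiver.isZero_res W),
    isPerfectObj_of_resolution (IceQuiver.resolution W h) 3 (IceQuiver.isZero_res W)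
      (IceQuiver.finite_res W), ?_⟩
  obtain ⟨b⟩ := IceQuiver.nonempty_Q_dualRes_iso W h
  let a := resolutionIso (IceQuiver.resolution W h)
  let ψ : Env.diagonalObj K (Q.FrozenJacobian W) ⟶
      (Env.omega K (Q.FrozenJacobian W))⟦((3 : ℕ) : ℤ)⟧ :=
    a.inv ≫ IceQuiver.comparison W ≫ b.hom
  obtain ⟨C, g, δ, hT⟩ := Pretriangulated.distinguished_cocone_triangle ψ
  have key (P : ObjectProperty (DerivedCategory (ModuleCat (Env K (Q.FrozenJacobian W)))))
      [P.IsTriangulated] [P.IsClosedUnderIsomorphisms] (hP : P.trW (IceQuiver.comparison W)) :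
      P C := by
    refine (P.trW_iff_of_distinguished _ hT).mp ?_
    exact (MorphismProperty.cancel_left_of_respectsIso P.trW a.inv _).mpr
      ((MorphismProperty.cancel_right_of_respectsIso P.trW _ b.hom).mpr hP)
  exact ⟨C, ψ, g, δ, hT,
    fun M hM => rHomVanishes_of_leftOrthogonal (key _ (IceQuiver.trW_comparison W _
      (Env.projective_left K _) (Env.mul_tmul_mem_left K _))) hM,
    fun N hN => rHomVanishes_of_leftOrthogonal (key _ (IceQuiver.trW_comparison W _
      (Env.projective_right K _) (Env.mul_tmul_mem_right K _))) hN⟩
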